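/- Let $G=(V,E,w)$ be a connected undirected graph with $n\ge 2$ linearly ordered (indexed) nodes and positive integral edge weights, and assume that the weights are polynomial in $n$: $w(e)\le n^{k}$ for all $e\in E$, for a constant $k$. Let $\mathrm{dist}(u,v)$ be the weight of a minimum-weight path. For an integer $1\le\tau\le n$, a $\tau$-clustering is a partition of $V$ into $\tau$ clusters, each with a distinguished member, its center; its radius is the maximum of $\mathrm{dist}(u,v)$ over all nodes $v$, $u$ being the center of the cluster of $v$; $R_G(\tau)$ is the minimum radius of a $\tau$-clustering. For $\Delta\ge 0$, $\ell_\Delta$ is the least number such that any two nodes at distance at most $\Delta$ are joined by a minimum-weight path with at most $\ell_\Delta$ edges. Given node states $(c_u,d_u)$, a $\Delta$-growing step on a weighted graph updates all nodes in parallel: for each edge $(u,v)$ of weight $w(u,v)\le\Delta$ with $d_u<\Delta$, $d_u+w(u,v)\le\Delta$ and $d_v>d_u+w(u,v)$, set $(c_v,d_v)=(c_u,d_u+w(u,v))$; among several updates of $v$, the one with the smallest $d_v$ and then with the smallest $c_u$ is performed. $\mathtt{CLUSTER}(G,\tau)$ is the following algorithm ($\log=\log_2$, $\gamma=4\ln 2$).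 Let $\Delta=\min_{e\in E} w(e)$, $C_1=\emptyset$, $G_1=(V_1,E_1)=G$, $i=1$. While $|V_i\setminus C_i|\ge 8\tau\log n$, perform a stage: 1. select each $v\in V_i\setminus C_i$ independently with probability $\gamma\tau\log n/|V_i\setminus C_i|$, and let $X$ consist of $C_i$ and the selected nodes; set $(c_u,d_u)=(u,0)$ for $u\in X$ and $(c_u,d_u)=(\mathrm{nil},\infty)$ for $u\in V_i\setminus X$; 2. perform $\Delta$-growing steps on $G_i$ until $V'=\{u\in V_i\setminus C_i: d_u\le\Delta\}$ has at least $|V_i\setminus C_i|/2$ elements or a step updates no state; if still $|V'|<|V_i\setminus C_i|/2$, replace $\Delta$ by $2\Delta$ and repeat 2 with the current states; 3. assign each $u\in V'$ to the cluster centered at $c_u$; obtain $G_{i+1}$ from $G_i$ by removing all nodes outside $X$ with $c_u$ defined, removing all edges $(u,v)$ with $c_u$ and $c_v$ both defined, and replacing each edge $(u,v)$ with $c_u$ defined and $c_v$ undefined by an edge $(c_u,v)$ of the same weight; let $C_{i+1}=X$ and increase $i$ by $1$. Finally, each $u\in V_i\setminus C_i$ becomes a singleton cluster, and the clustering is returned.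 Theorem. There is a constant $C>0$ depending only on $k$ such that for every such $G$ and $\tau$, with probability at least $1-1/n$, $\mathtt{CLUSTER}(G,\tau)$ terminates and returns a clustering with at most $C\,\tau\log^2 n$ clusters and of radius at most $C\,R_G(\tau)\log n$, after performing at most $C\,\ell_{R_G(\tau)}\log n$ $\Delta$-growing steps in total, each of them with $\Delta\le C\,R_G(\tau)$. -/

import Mathlib

open scoped ENNReal NNReal

/-- An undirected (simple) graph with a positive integral weight on each edge. -/
structure WGraph (V : Type*) extends SimpleGraph V where
  /-- The weight function; only its values on edges matter. -/
  weight : Sym2 V → ℕ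
  weight_pos : ∀ e ∈ toSimpleGraph.edgeSet, 0 < weight e

namespace WGraph

variable {V : Type*}

/-- The weight of a walk: the sum of the weights of its edges. -/
def walkWeight (G : WGraph V) {u v : V} (p : G.toSimpleGraph.Walk u v) : ℕ :=
  (p.edges.map G.weight).sum

/-- `dist(u,v)`: the weight of a minimum-weight path from `u` to `v`
(weights are positive, so minimum-weight walks are paths). -/
noncomputable def wdist (G : WGraph V) (u v : V) : ℕ :=
  sInf {m | ∃ p : G.toSimpleGraph.Walk u v, G.walkWeight p = m}

/-- `ℓ_Δ`: the least `L` such that any two nodes at distance at most `Δ` are joined by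
a minimum-weight path with at most `L` edges. -/
noncomputable def ell (G : WGraph V) (Δ : ℕ) : ℕ :=
  sInf {L | ∀ u v : V, G.wdist u v ≤ Δ →
    ∃ p : G.toSimpleGraph.Walk u v, G.walkWeight p = G.wdist u v ∧ p.length ≤ L}

/-- The minimum edge weight. -/
noncomputable def minWeight (G : WGraph V) : ℕ :=
  sInf {x | ∃ e ∈ G.edgeSet, G.weight e = x}

open Classical in
/-- The edges of `G` as triples `(u, v, w(u,v))`; each edge occurs in both orientations. -/
noncomputable def edgeTriples [Fintype V] (G : WGraph V) : Finset (V × V × ℕ) :=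
  ((Finset.univ : Finset (V × V)).filter fun p => G.Adj p.1 p.2).image
    fun p => (p.1, p.2, G.weight s(p.1, p.2))

end WGraph

/-- A clustering of `V`: a partition of `V` into clusters, each with a distinguished member,
its center.  It is given by the map sending each node to the center of its cluster: the
clusters are the fibres of this map, and each center lies in its own cluster. -/
structure Clustering (V : Type*) where
  centerOf : V → V
  centerOf_centerOf : ∀ v, centerOf (centerOf v) = centerOf v

namespace Clustering

variable {V : Type*} [Fintype V]

open Classical in
/-- The number of clusters; a `t`-clustering is a clustering with `t` clusters. -/
noncomputable def numClusters (K : Clustering V) : ℕ :=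
  (Finset.univ.image K.centerOf).card

/-- The radius: the maximum distance of a node from the center of its cluster. -/
noncomputable def radius (K : Clustering V) (G : WGraph V) : ℕ :=
  Finset.univ.sup fun v => G.wdist (K.centerOf v) v

end Clustering

/-- `R_G(τ)`: the minimum radius of a `τ`-clustering of `G`. -/
noncomputable def optRadius {V : Type*} [Fintype V] (G : WGraph V) (τ : ℕ) : ℕ :=
  sInf {r | ∃ K : Clustering V, K.numClusters = τ ∧ K.radius G = r}

/-- The law of the random subset of `U` that contains each element of `U`, independently,
with probability `p`. -/
noncomputable def randomSubset {V : Type*} [DecidableEq V] (U : Finset V) (p : ℝ≥0)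
    (hp : p ≤ 1) : PMF (Finset V) :=
  PMF.ofFinset
    (fun S => if S ⊆ U then ((p ^ S.card * (1 - p) ^ (U.card - S.card) : ℝ≥0) : ℝ≥0∞) else 0)
    U.powerset
    (by
      have h : ∑ S ∈ U.powerset, (p ^ S.card * (1 - p) ^ (U.card - S.card) : ℝ≥0) = 1 := by
        rw [Finset.sum_pow_mul_eq_add_pow, add_tsub_cancel_of_le hp, one_pow]
      rw [Finset.sum_congr rfl fun S hS => if_pos (Finset.mem_powerset.1 hS),
        ← ENNReal.ofNNReal_finsetSum, h, ENNReal.coe_one])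
    (by
      intro S hS
      exact if_neg fun h => hS (Finset.mem_powerset.2 h))

/-! ### The algorithm `CLUSTER(G, τ)` -/

namespace ClusterAlg

/-- The node states: `some (d_u, c_u)`, or `none` for `c_u` undefined and `d_u = ∞`. -/
abbrev NodeStates (V : Type*) := V → Option (ℕ × V)

/-- The variable `d_u`, with value `⊤` if `c_u` is undefined. -/
def dVal {V : Type*} (s : NodeStates V) (u : V) : ℕ∞ :=
  match s u with
  | none => ⊤
  | some x => (x.1 : ℕ∞)

section Growing

variable {V : Type*} [LinearOrder V]

/-- The updates `(d_u + w(u,v), c_u)` offered to the node `v` in a `Δ`-growing step on the graph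
with oriented edges `E`: one for each light edge `(u,v)` with `d_u < Δ`, `d_u + w(u,v) ≤ Δ`
and `d_v > d_u + w(u,v)`. -/
def offers (E : Finset (V × V × ℕ)) (Δ : ℕ) (s : NodeStates V) (v : V) : Finset (ℕ ×ₗ V) :=
  E.biUnion fun e =>
    match s e.1 with
    | none => ∅
    | some (d, c) =>
      if e.2.1 = v ∧ d < Δ ∧ e.2.2 ≤ Δ ∧ d + e.2.2 ≤ Δ ∧ ((d + e.2.2 : ℕ) : ℕ∞) < dVal s v
      then {toLex (d + e.2.2, c)} else ∅

/-- A `Δ`-growing step.  All nodes are updated in parallel; among several updates offered to a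
node, the one with the smallest new `d`, and then the smallest center, is performed. -/
def growStep (E : Finset (V × V × ℕ)) (Δ : ℕ) (s : NodeStates V) : NodeStates V := fun v =>
  if h : (offers E Δ s v).Nonempty then some (ofLex ((offers E Δ s v).min' h)) else s v

/-- The edges after the contraction: edges with both ends covered disappear, edges with both
ends uncovered stay, and a covered end `u` of any other edge is replaced by `c_u`. -/
def contractEdges (E : Finset (V × V × ℕ)) (s : NodeStates V) : Finset (V × V × ℕ) :=
  E.biUnion fun e =>
    match s e.1, s e.2.1 with
    | some _, some _ => ∅
    | none, none => {e}
    | some (_, c), none => {(c, e.2.1, e.2.2)}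
    | none, some (_, c) => {(e.1, c, e.2.2)}

end Growing

/-- Where the execution stands: at the test of the outer loop, about to perform a growing step,
or terminated. -/
inductive Phase where
  | outer
  | grow
  | done

/-- The configuration of an execution. -/
structure Config (V : Type*) where
  phase : Phase
  /-- The node set `V_i` of the current contracted graph. -/
  nodes : Finset V
  /-- Its edge set `E_i`: triples (end, end, weight), in both orientations. -/
  edges : Finset (V × V × ℕ)
  /-- The set `C_i` of centers of the clusters grown in previous stages. -/
  centers : Finset V
  /-- The set `X` of all centers of the current stage. -/
  X : Finset V
  /-- The current guess `Δ`. -/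
  Δ : ℕ
  /-- The states `(d_u, c_u)` in the current stage. -/
  state : NodeStates V
  /-- The center of the cluster to which each node has been assigned so far, if any. -/
  assign : V → Option V
  /-- The values of `Δ` in all `Δ`-growing steps performed so far, the latest first. -/
  trace : List ℕ

section Machine

variable {V : Type*} [LinearOrder V]

/-- The set `V_i - C_i` of uncovered nodes. -/
def Config.uncovered (c : Config V) : Finset V := c.nodes \ c.centers

/-- The beginning of a stage, with `S` the set of newly selected centers. -/
def startStage (c : Config V) (S : Finset V) : Config V :=
  { c with
    phase := .grow
    X := c.centers ∪ S
    state := fun u => if u ∈ c.centers ∪ S then some (0, u) else none }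

/-- The set `V' = {u ∈ V_i - C_i : d_u ≤ Δ}` for the node states `s`. -/
def reached (c : Config V) (s : NodeStates V) : Finset V :=
  c.uncovered.filter fun u => dVal s u ≤ (c.Δ : ℕ∞)

/-- The end of a stage with final node states `s`: the nodes in `V'` are assigned to clusters,
and the graph is contracted. -/
def endStage (c : Config V) (s : NodeStates V) : Config V :=
  { c with
    phase := .outer
    nodes := c.X ∪ c.nodes.filter fun u => s u = none
    edges := contractEdges c.edges s
    centers := c.X
    state := s
    assign := fun u => if u ∈ reached c s then (s u).map Prod.snd else c.assign u }

/-- One iteration of the loop of `PartialGrowth`: a `Δ`-growing step is performed.  If then at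
least half of the nodes in `V_i - C_i` are reached, `PartialGrowth` returns and the stage ends.
If not, but no state was updated, `PartialGrowth` returns and is invoked again with `2Δ`.
Otherwise the loop goes on. -/
def growNext [Fintype V] (c : Config V) : Config V :=
  let s := growStep c.edges c.Δ c.state
  let c' : Config V := { c with trace := c.Δ :: c.trace }
  if c.uncovered.card ≤ 2 * (reached c s).card then endStage c' s
  else if s = c.state then { c' with Δ := 2 * c.Δ }
  else { c' with state := s }

/-- The termination: each uncovered node becomes a singleton cluster. -/
def finish (c : Config V) : Config V :=
  { c with
    phase := .done
    assign := fun u => if u ∈ c.uncovered then some u else c.assign u }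

/-- The probability `γ τ log n / m`, with `γ = 4 ln 2`, of the selection as a center when there
are `m` uncovered nodes.  (When `m ≥ 8 τ log n` it is less than `1`, and `min` is idle.) -/
noncomputable def selProb (n τ m : ℕ) : ℝ≥0 :=
  min 1 (Real.toNNReal (4 * Real.log 2 * τ * Real.logb 2 n / m))

open Classical in
/-- One transition of an execution on a graph that originally has `n` nodes. -/
noncomputable def step [Fintype V] (n τ : ℕ) (c : Config V) : PMF (Config V) :=
  match c.phase with
  | .outer =>
    if 8 * (τ : ℝ) * Real.logb 2 n ≤ (c.uncovered.card : ℝ) then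
      (randomSubset c.uncovered (selProb n τ c.uncovered.card) (min_le_left _ _)).map
        (startStage c)
    else PMF.pure (finish c)
  | .grow => PMF.pure (growNext c)
  | .done => PMF.pure c

/-- The initial configuration. -/
noncomputable def init [Fintype V] (G : WGraph V) : Config V where
  phase := .outer
  nodes := Finset.univ
  edges := G.edgeTriples
  centers := ∅
  X := ∅
  Δ := G.minWeight
  state := fun _ => none
  assign := fun _ => none
  trace := []

/-- The law of the configuration of `CLUSTER(G, τ)` after `N` transitions. -/
noncomputable def run [Fintype V] (G : WGraph V) (τ : ℕ) : ℕ → PMF (Config V)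
  | 0 => PMF.pure (init G)
  | N + 1 => (run G τ N).bind (step (Fintype.card V) τ)

/-- The probability that `CLUSTER(G, τ)` terminates in a configuration with the property `P`. -/
noncomputable def prTerminatesWith [Fintype V] (G : WGraph V) (τ : ℕ) (P : Config V → Prop) :
    ℝ≥0∞ :=
  ⨆ N : ℕ, (run G τ N).toOuterMeasure {c | c.phase = .done ∧ P c}

end Machine

end ClusterAlg

namespace WGraph

variable {V : Type*} {G : WGraph V}

@[simp] theorem walkWeight_nil (u : V) :
    G.walkWeight (SimpleGraph.Walk.nil : G.toSimpleGraph.Walk u u) = 0 := rfl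

@[simp] theorem walkWeight_cons {u v w : V} (h : G.Adj u v) (p : G.toSimpleGraph.Walk v w) :
    G.walkWeight (SimpleGraph.Walk.cons h p) = G.weight s(u, v) + G.walkWeight p := by
  simp [walkWeight]

@[simp] theorem walkWeight_append {u v w : V} (p : G.toSimpleGraph.Walk u v)
    (q : G.toSimpleGraph.Walk v w) :
    G.walkWeight (p.append q) = G.walkWeight p + G.walkWeight q := by
  simp [walkWeight, SimpleGraph.Walk.edges_append]

@[simp] theorem walkWeight_reverse {u v : V} (p : G.toSimpleGraph.Walk u v) :
    G.walkWeight p.reverse = G.walkWeight p := by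
  simp [walkWeight, SimpleGraph.Walk.edges_reverse]

theorem weight_pos_of_adj {u v : V} (h : G.Adj u v) : 0 < G.weight s(u, v) :=
  G.weight_pos _ h

theorem wdist_le_walkWeight {u v : V} (p : G.toSimpleGraph.Walk u v) :
    G.wdist u v ≤ G.walkWeight p :=
  Nat.sInf_le ⟨p, rfl⟩

theorem wdist_le_weight {u v : V} (h : G.Adj u v) : G.wdist u v ≤ G.weight s(u, v) := by
  simpa using wdist_le_walkWeight (SimpleGraph.Walk.cons h .nil)

@[simp] theorem wdist_self (u : V) : G.wdist u u = 0 := by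
  simpa using wdist_le_walkWeight (SimpleGraph.Walk.nil : G.toSimpleGraph.Walk u u)

theorem exists_walkWeight_eq_wdist (hG : G.Connected) (u v : V) :
    ∃ p : G.toSimpleGraph.Walk u v, G.walkWeight p = G.wdist u v := by
  obtain ⟨p⟩ := hG.preconnected u v
  exact Nat.sInf_mem (s := {m | ∃ p : G.toSimpleGraph.Walk u v, G.walkWeight p = m}) ⟨_, p, rfl⟩

theorem wdist_triangle (hG : G.Connected) (u v w : V) :
    G.wdist u w ≤ G.wdist u v + G.wdist v w := by
  obtain ⟨p, hp⟩ := exists_walkWeight_eq_wdist hG u v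
  obtain ⟨q, hq⟩ := exists_walkWeight_eq_wdist hG v w
  rw [← hp, ← hq, ← walkWeight_append]
  exact wdist_le_walkWeight _

theorem wdist_comm (hG : G.Connected) (u v : V) : G.wdist u v = G.wdist v u := by
  have key : ∀ a b, G.wdist a b ≤ G.wdist b a := fun a b => by
    obtain ⟨p, hp⟩ := exists_walkWeight_eq_wdist hG b a
    rw [← hp, ← walkWeight_reverse]
    exact wdist_le_walkWeight _
  exact le_antisymm (key u v) (key v u)

theorem wdist_le_add_weight (hG : G.Connected) {u v w : V} (h : G.Adj v w) :
    G.wdist u w ≤ G.wdist u v + G.weight s(v, w) :=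
  (wdist_triangle hG u v w).trans (Nat.add_le_add_left (wdist_le_weight h) _)

/-- Any two nodes at distance at most `Δ` are joined by a minimum-weight path with at most `L`
edges. -/
def HopBound (G : WGraph V) (Δ L : ℕ) : Prop :=
  ∀ u v : V, G.wdist u v ≤ Δ →
    ∃ p : G.toSimpleGraph.Walk u v, G.walkWeight p = G.wdist u v ∧ p.length ≤ L

theorem hopBound_ell [Fintype V] (hG : G.Connected) (Δ : ℕ) : G.HopBound Δ (G.ell Δ) := by
  choose p hp using exists_walkWeight_eq_wdist hG
  refine Nat.sInf_mem (s := {L | G.HopBound Δ L})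
    ⟨(Finset.univ : Finset (V × V)).sup fun x => (p x.1 x.2).length, fun u v _ => ?_⟩
  exact ⟨p u v, hp u v, Finset.le_sup (f := fun x : V × V => (p x.1 x.2).length)
    (Finset.mem_univ (u, v))⟩

theorem exists_crossing_edge (hG : G.Connected) {o : V} {r : ℕ} {u v : V}
    (p : G.toSimpleGraph.Walk u v) (hu : G.wdist o u ≤ r) (hv : r < G.wdist o v) :
    ∃ a b, G.Adj a b ∧ G.wdist o a ≤ r ∧ r < G.wdist o b ∧
      G.wdist u a + G.weight s(a, b) + G.wdist b v ≤ G.walkWeight p := by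
  induction p with
  | nil => omega
  | @cons u x v h p ih =>
    by_cases hx : G.wdist o x ≤ r
    · obtain ⟨a, b, hab, ha, hb, hw⟩ := ih hx hv
      refine ⟨a, b, hab, ha, hb, ?_⟩
      have h1 := wdist_triangle hG u x a
      have h2 := wdist_le_weight h
      rw [walkWeight_cons]
      omega
    · refine ⟨u, x, h, hu, not_le.1 hx, ?_⟩
      have := wdist_le_walkWeight p
      simp only [wdist_self, walkWeight_cons]
      omega

theorem HopBound.mul (hG : G.Connected) {r l : ℕ} (h : G.HopBound r l) (q : ℕ) :
    ∀ u v : V, G.wdist u v < q * (r + 1) →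
      ∃ p : G.toSimpleGraph.Walk u v, G.walkWeight p = G.wdist u v ∧ p.length ≤ q * (l + 1) := by
  induction q with
  | zero => intro u v huv; omega
  | succ q ih =>
    intro u v huv
    by_cases hr : G.wdist u v ≤ r
    · obtain ⟨p, hp, hl⟩ := h u v hr
      exact ⟨p, hp, by nlinarith⟩
    · obtain ⟨p, hp⟩ := exists_walkWeight_eq_wdist hG u v
      obtain ⟨a, b, hab, ha, hb, hw⟩ := exists_crossing_edge hG p (o := u) (by simp) (not_le.1 hr)
      have h1 := wdist_le_add_weight hG (u := u) hab
      have h2 := wdist_triangle hG u b v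
      obtain ⟨p₁, hp₁, hl₁⟩ := h u a ha
      obtain ⟨p₂, hp₂, hl₂⟩ := ih b v (by rw [add_mul] at huv; omega)
      refine ⟨p₁.append (.cons hab p₂), ?_, ?_⟩
      · refine le_antisymm ?_ (wdist_le_walkWeight _)
        rw [walkWeight_append, walkWeight_cons]
        omega
      · rw [SimpleGraph.Walk.length_append, SimpleGraph.Walk.length_cons, add_mul]
        omega

theorem HopBound.one_le {r l : ℕ} (h : G.HopBound r l) {u v : V} (huv : G.wdist u v ≤ r)
    (hne : u ≠ v) : 1 ≤ l := by
  obtain ⟨p, -, hl⟩ := h u v huv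
  cases p with
  | nil => exact absurd rfl hne
  | cons h p => rw [SimpleGraph.Walk.length_cons] at hl; omega

theorem minWeight_le_weight {u v : V} (h : G.Adj u v) : G.minWeight ≤ G.weight s(u, v) :=
  Nat.sInf_le ⟨s(u, v), h, rfl⟩

theorem minWeight_le_wdist (hG : G.Connected) {u v : V} (hne : u ≠ v) :
    G.minWeight ≤ G.wdist u v := by
  obtain ⟨p, hp⟩ := exists_walkWeight_eq_wdist hG u v
  cases p with
  | nil => exact absurd rfl hne
  | cons h p =>
    rw [walkWeight_cons] at hp
    have := minWeight_le_weight h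
    omega

theorem minWeight_pos (hG : G.Connected) [Nontrivial V] : 0 < G.minWeight := by
  obtain ⟨u, v, huv⟩ := exists_pair_ne V
  obtain ⟨p⟩ := hG.preconnected u v
  cases p with
  | nil => exact absurd rfl huv
  | cons h p =>
    obtain ⟨e, he, hw⟩ := Nat.sInf_mem (s := {x | ∃ e ∈ G.edgeSet, G.weight e = x})
      ⟨_, s(u, _), h, rfl⟩
    exact (G.weight_pos e he).trans_eq hw

theorem walkWeight_le_length_mul {W : ℕ} (hW : ∀ e ∈ G.edgeSet, G.weight e ≤ W) {u v : V}
    (p : G.toSimpleGraph.Walk u v) : G.walkWeight p ≤ p.length * W := by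
  induction p with
  | nil => simp
  | cons h p ih =>
    rw [walkWeight_cons, SimpleGraph.Walk.length_cons, add_mul, one_mul, add_comm]
    exact Nat.add_le_add ih (hW _ h)

theorem wdist_le_card_mul [Fintype V] (hG : G.Connected) {W : ℕ}
    (hW : ∀ e ∈ G.edgeSet, G.weight e ≤ W) (u v : V) : G.wdist u v ≤ Fintype.card V * W := by
  classical
  obtain ⟨p⟩ := hG.preconnected u v
  refine (wdist_le_walkWeight p.toPath.1).trans ((walkWeight_le_length_mul hW _).trans ?_)
  exact Nat.mul_le_mul_right _ p.toPath.2.length_lt.le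

end WGraph

namespace Clustering

variable {V : Type*} [Fintype V]

theorem wdist_centerOf_le (K : Clustering V) (G : WGraph V) (v : V) :
    G.wdist (K.centerOf v) v ≤ K.radius G :=
  Finset.le_sup (f := fun v => G.wdist (K.centerOf v) v) (Finset.mem_univ v)

theorem numClusters_eq_card_image [DecidableEq V] (K : Clustering V) :
    K.numClusters = (Finset.univ.image K.centerOf).card := by
  rw [numClusters]
  congr!

theorem exists_numClusters_eq {t : ℕ} (h1 : 1 ≤ t) (h2 : t ≤ Fintype.card V) :
    ∃ K : Clustering V, K.numClusters = t := by
  classical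
  obtain ⟨s, -, hs⟩ := Finset.exists_subset_card_eq (s := (Finset.univ : Finset V)) h2
  obtain ⟨x, hx⟩ := Finset.card_pos.1 (hs ▸ h1 : 0 < s.card)
  have hmem : ∀ v, (if v ∈ s then v else x) ∈ s := fun v => by split_ifs <;> assumption
  refine ⟨⟨fun v => if v ∈ s then v else x, fun v => if_pos (hmem v)⟩, ?_⟩
  rw [← hs]
  refine congrArg Finset.card (Finset.ext fun v => ?_)
  simp only [Finset.mem_image, Finset.mem_univ, true_and]
  exact ⟨fun ⟨u, hu⟩ => hu ▸ hmem u, fun hv => ⟨v, if_pos hv⟩⟩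

theorem exists_centerOf_ne {K : Clustering V} (h : K.numClusters < Fintype.card V) :
    ∃ v, K.centerOf v ≠ v := by
  classical
  by_contra! hK
  refine h.ne (congrArg Finset.card (Finset.ext fun v => ?_))
  simpa using ⟨v, hK v⟩

end Clustering

section OptRadius

variable {V : Type*} [Fintype V] {G : WGraph V} {τ : ℕ}

theorem exists_radius_eq_optRadius (h1 : 1 ≤ τ) (h2 : τ ≤ Fintype.card V) :
    ∃ K : Clustering V, K.numClusters = τ ∧ K.radius G = optRadius G τ := by
  obtain ⟨K, hK⟩ := Clustering.exists_numClusters_eq h1 h2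
  exact Nat.sInf_mem (s := {r | ∃ K : Clustering V, K.numClusters = τ ∧ K.radius G = r})
    ⟨_, K, hK, rfl⟩

theorem exists_ne_wdist_le_optRadius (h1 : 1 ≤ τ) (h2 : τ < Fintype.card V) :
    ∃ u v, u ≠ v ∧ G.wdist u v ≤ optRadius G τ := by
  obtain ⟨K, hK, hr⟩ := exists_radius_eq_optRadius (G := G) h1 h2.le
  obtain ⟨v, hv⟩ := Clustering.exists_centerOf_ne (hK.trans_lt h2)
  exact ⟨_, v, hv, hr ▸ K.wdist_centerOf_le G v⟩

theorem optRadius_le (hG : G.Connected) {W : ℕ} (hW : ∀ e ∈ G.edgeSet, G.weight e ≤ W)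
    (h1 : 1 ≤ τ) (h2 : τ ≤ Fintype.card V) : optRadius G τ ≤ Fintype.card V * W := by
  obtain ⟨K, -, hr⟩ := exists_radius_eq_optRadius (G := G) h1 h2
  rw [← hr]
  exact Finset.sup_le fun v _ => G.wdist_le_card_mul hG hW _ _

end OptRadius

section RandomSubset

variable {V : Type*}

/-- The probability of the set `S` under the law `randomSubset U p`. -/
noncomputable def selWeight (U : Finset V) (p : ℝ) (S : Finset V) : ℝ :=
  p ^ S.card * (1 - p) ^ (U.card - S.card)

theorem selWeight_nonneg {p : ℝ} (h0 : 0 ≤ p) (h1 : p ≤ 1) (U S : Finset V) :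
    0 ≤ selWeight U p S :=
  mul_nonneg (pow_nonneg h0 _) (pow_nonneg (sub_nonneg.2 h1) _)

theorem sum_selWeight_card_gt (U : Finset V) {p : ℝ} (h0 : 0 ≤ p) (h1 : p ≤ 1) (t : ℝ) :
    ∑ S ∈ U.powerset with t < (S.card : ℝ), selWeight U p S ≤
      Real.exp (p * U.card) * (2 : ℝ) ^ (-t) := by
  calc ∑ S ∈ U.powerset with t < (S.card : ℝ), selWeight U p S
      ≤ ∑ S ∈ U.powerset with t < (S.card : ℝ),
          ((2 * p) ^ S.card * (1 - p) ^ (U.card - S.card)) * (2 : ℝ) ^ (-t) := by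
        refine Finset.sum_le_sum fun S hS => ?_
        have ht := (Finset.mem_filter.1 hS).2
        have h2 : 1 ≤ (2 : ℝ) ^ S.card * (2 : ℝ) ^ (-t) := by
          rw [← Real.rpow_natCast, ← Real.rpow_add two_pos]
          exact Real.one_le_rpow one_le_two (by linarith)
        calc selWeight U p S ≤ selWeight U p S * ((2 : ℝ) ^ S.card * (2 : ℝ) ^ (-t)) :=
              le_mul_of_one_le_right (selWeight_nonneg h0 h1 U S) h2
          _ = _ := by rw [selWeight, mul_pow]; ring
    _ ≤ ∑ S ∈ U.powerset,
          ((2 * p) ^ S.card * (1 - p) ^ (U.card - S.card)) * (2 : ℝ) ^ (-t) := by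
        refine Finset.sum_le_sum_of_subset_of_nonneg (Finset.filter_subset _ _) fun S _ _ => ?_
        have := sub_nonneg.2 h1
        positivity
    _ = (1 + p) ^ U.card * (2 : ℝ) ^ (-t) := by
        rw [← Finset.sum_mul, Finset.sum_pow_mul_eq_add_pow]
        ring_nf
    _ ≤ Real.exp (p * U.card) * (2 : ℝ) ^ (-t) := by
        refine mul_le_mul_of_nonneg_right ?_ (by positivity)
        rw [mul_comm p, Real.exp_nat_mul]
        exact pow_le_pow_left₀ (by linarith) (by linarith [Real.add_one_le_exp p]) _

variable [DecidableEq V]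

theorem tsum_randomSubset_mul_ite (U : Finset V) (p : ℝ≥0) (hp : p ≤ 1) (P : Finset V → Prop)
    [DecidablePred P] :
    ∑' S, randomSubset U p hp S * (if P S then 1 else 0) =
      ENNReal.ofReal (∑ S ∈ U.powerset with P S, selWeight U p S) := by
  rw [tsum_eq_sum (s := U.powerset.filter P), ENNReal.ofReal_sum_of_nonneg]
  · refine Finset.sum_congr rfl fun S hS => ?_
    rw [Finset.mem_filter] at hS
    rw [if_pos hS.2, mul_one, randomSubset, PMF.ofFinset_apply,
      if_pos (Finset.mem_powerset.1 hS.1), ENNReal.ofReal, ENNReal.coe_inj]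
    refine NNReal.eq ((?_ : _ = selWeight U p S).trans
      (Real.coe_toNNReal _ (selWeight_nonneg p.2 hp U S)).symm)
    simp [selWeight, NNReal.coe_sub hp]
  · exact fun S _ => selWeight_nonneg p.2 hp U S
  · intro S hS
    rw [Finset.mem_filter, not_and] at hS
    by_cases hU : S ⊆ U
    · rw [if_neg (hS (Finset.mem_powerset.2 hU)), mul_zero]
    · rw [randomSubset, PMF.ofFinset_apply, if_neg hU, zero_mul]

theorem sum_selWeight_disjoint {U A : Finset V} (hA : A ⊆ U) (p : ℝ) :
    ∑ S ∈ U.powerset with Disjoint S A, selWeight U p S = (1 - p) ^ A.card := by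
  have hset : (U.powerset.filter fun S => Disjoint S A) = (U \ A).powerset := by
    ext S
    simp [Finset.subset_sdiff]
  have hcard : (U \ A).card + A.card = U.card := by
    rw [Finset.card_sdiff_of_subset hA, Nat.sub_add_cancel (Finset.card_le_card hA)]
  have hw : ∀ S ∈ (U \ A).powerset, selWeight U p S =
      (p ^ S.card * (1 - p) ^ ((U \ A).card - S.card)) * (1 - p) ^ A.card := fun S hS => by
    have := Finset.card_le_card (Finset.mem_powerset.1 hS)
    rw [selWeight, mul_assoc, ← pow_add]
    congr 2
    omega
  rw [hset, Finset.sum_congr rfl hw, ← Finset.sum_mul, Finset.sum_pow_mul_eq_add_pow]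
  simp

/-- A selection `S` from `U` is good if it is small and meets every fibre of `f` that contains at
least a fraction `1 / (2τ)` of `U`. -/
def GoodSelection (U : Finset V) (f : V → V) (τ : ℕ) (t : ℝ) (S : Finset V) : Prop :=
  S ⊆ U ∧ (S.card : ℝ) ≤ t ∧
    ∀ q, U.card ≤ 2 * τ * (U.filter fun u => f u = q).card → ∃ x ∈ S, f x = q

theorem sum_biUnion_le_sum_sum {α β : Type*} [DecidableEq β] (s : Finset α) (t : α → Finset β)
    (g : β → ℝ) (hg : ∀ b, 0 ≤ g b) : ∑ b ∈ s.biUnion t, g b ≤ ∑ a ∈ s, ∑ b ∈ t a, g b := by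
  classical
  induction s using Finset.induction_on with
  | empty => simp
  | insert a s ha ih =>
    rw [Finset.biUnion_insert, Finset.sum_insert ha]
    refine le_trans ?_ (add_le_add_right ih _)
    rw [← Finset.sum_union_inter]
    exact le_add_of_nonneg_right (Finset.sum_nonneg fun b _ => hg b)

open Classical in
theorem sum_selWeight_not_good (U : Finset V) (f : V → V) (Q : Finset V) (hQ : ∀ u, f u ∈ Q)
    {τ : ℕ} (hτ : Q.card = τ) (hτ0 : 0 < τ) (hU : 0 < U.card) {p : ℝ} (h0 : 0 ≤ p) (h1 : p ≤ 1)
    (t : ℝ) :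
    ∑ S ∈ U.powerset with ¬ GoodSelection U f τ t S, selWeight U p S ≤
      τ * Real.exp (-(p * U.card / (2 * τ))) + Real.exp (p * U.card) * (2 : ℝ) ^ (-t) := by
  set A : V → Finset V := fun q => U.filter fun u => f u = q with hAdef
  set big : Finset V := Q.filter fun q => U.card ≤ 2 * τ * (A q).card with hbig
  have hnn : ∀ S : Finset V, 0 ≤ selWeight U p S := selWeight_nonneg h0 h1 U
  have hsub : (U.powerset.filter fun S => ¬ GoodSelection U f τ t S) ⊆
      (big.biUnion fun q => U.powerset.filter fun S => Disjoint S (A q)) ∪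
        U.powerset.filter fun S => t < (S.card : ℝ) := by
    intro S hS
    rw [Finset.mem_filter, Finset.mem_powerset] at hS
    obtain ⟨hSU, hbad⟩ := hS
    rw [Finset.mem_union, Finset.mem_biUnion]
    by_cases ht : t < (S.card : ℝ)
    · exact Or.inr (Finset.mem_filter.2 ⟨Finset.mem_powerset.2 hSU, ht⟩)
    · left
      have : ∃ q, U.card ≤ 2 * τ * (A q).card ∧ ∀ x ∈ S, f x ≠ q := by
        by_contra! hcon
        exact hbad ⟨hSU, not_lt.1 ht, hcon⟩
      obtain ⟨q, hq, hx⟩ := this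
      have hne : (A q).Nonempty := by
        rw [Finset.nonempty_iff_ne_empty]
        intro he
        rw [he, Finset.card_empty, mul_zero] at hq
        omega
      obtain ⟨u, hu⟩ := hne
      refine ⟨q, Finset.mem_filter.2 ⟨(Finset.mem_filter.1 hu).2 ▸ hQ u, hq⟩,
        Finset.mem_filter.2 ⟨Finset.mem_powerset.2 hSU, ?_⟩⟩
      rw [Finset.disjoint_left]
      exact fun x hxS hxA => hx x hxS (Finset.mem_filter.1 hxA).2
  have hτ' : (0 : ℝ) < τ := by exact_mod_cast hτ0
  have hmiss : ∀ q ∈ big, ∑ S ∈ U.powerset with Disjoint S (A q), selWeight U p S ≤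
      Real.exp (-(p * U.card / (2 * τ))) := by
    intro q hq
    have hcard : (U.card : ℝ) ≤ 2 * τ * (A q).card := by
      exact_mod_cast (Finset.mem_filter.1 hq).2
    rw [sum_selWeight_disjoint (Finset.filter_subset _ _)]
    calc (1 - p) ^ (A q).card ≤ Real.exp (-p) ^ (A q).card :=
          pow_le_pow_left₀ (sub_nonneg.2 h1) (by linarith [Real.add_one_le_exp (-p)]) _
      _ = Real.exp (-(p * (A q).card)) := by rw [← Real.exp_nat_mul]; ring_nf
      _ ≤ _ := by
          refine Real.exp_le_exp.2 (neg_le_neg ?_)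
          rw [div_le_iff₀ (by positivity)]
          nlinarith [mul_le_mul_of_nonneg_left hcard h0]
  calc _ ≤ ∑ S ∈ (big.biUnion fun q => U.powerset.filter fun S => Disjoint S (A q)) ∪
        U.powerset.filter fun S => t < (S.card : ℝ), selWeight U p S :=
        Finset.sum_le_sum_of_subset_of_nonneg hsub fun S _ _ => hnn S
    _ ≤ ∑ S ∈ (big.biUnion fun q => U.powerset.filter fun S => Disjoint S (A q)),
          selWeight U p S + ∑ S ∈ U.powerset with t < (S.card : ℝ), selWeight U p S := by
        rw [← Finset.sum_union_inter]
        exact le_add_of_nonneg_right (Finset.sum_nonneg fun S _ => hnn S)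
    _ ≤ _ := by
        refine add_le_add ?_ (sum_selWeight_card_gt U h0 h1 t)
        calc _ ≤ ∑ q ∈ big, ∑ S ∈ U.powerset with Disjoint S (A q), selWeight U p S :=
              sum_biUnion_le_sum_sum _ _ _ hnn
          _ ≤ big.card • Real.exp (-(p * U.card / (2 * τ))) := Finset.sum_le_card_nsmul _ _ _ hmiss
          _ ≤ _ := by
            rw [nsmul_eq_mul, ← hτ]
            refine mul_le_mul_of_nonneg_right ?_ (Real.exp_pos _).le
            exact_mod_cast Finset.card_le_card (Finset.filter_subset _ _)

theorem le_two_mul_card_of_goodSelection {U S : Finset V} {f : V → V} {Q : Finset V}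
    (hQ : ∀ u, f u ∈ Q) {τ : ℕ} (hτ : Q.card = τ) {t : ℝ} (hS : GoodSelection U f τ t S)
    {P : V → Prop} [DecidablePred P] (hP : ∀ u ∈ U, ∀ x ∈ S, f x = f u → P u) :
    U.card ≤ 2 * (U.filter P).card := by
  set A : V → Finset V := fun q => U.filter fun u => f u = q with hA
  have hsmall : ∀ q ∈ Q, 2 * τ * ((U.filter fun u => ¬ P u).filter fun u => f u = q).card ≤
      U.card := by
    intro q _
    by_cases hq : U.card ≤ 2 * τ * (A q).card
    · obtain ⟨x, hx, hfx⟩ := hS.2.2 q hq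
      rw [Finset.card_eq_zero.2, mul_zero]
      · exact Nat.zero_le _
      · refine Finset.eq_empty_of_forall_notMem fun u hu => ?_
        simp only [Finset.mem_filter] at hu
        exact hu.1.2 (hP u hu.1.1 x hx (hfx.trans hu.2.symm))
    · refine le_trans (Nat.mul_le_mul_left _ (Finset.card_le_card ?_)) (not_le.1 hq).le
      exact Finset.filter_subset_filter _ (Finset.filter_subset _ _)
  have hsum := Finset.card_eq_sum_card_fiberwise (s := U.filter fun u => ¬ P u) (t := Q) (f := f)
    fun u _ => hQ u
  have h1 : 2 * τ * (U.filter fun u => ¬ P u).card ≤ τ * U.card := by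
    rw [hsum, Finset.mul_sum, ← hτ, ← smul_eq_mul (a := Q.card), hτ]
    exact (Finset.sum_le_card_nsmul _ _ _ hsmall).trans_eq (by rw [hτ])
  have h2 := Finset.card_filter_add_card_filter_not (s := U) P
  rcases Nat.eq_zero_or_pos τ with h0 | h0
  · have hU : U = ∅ := Finset.eq_empty_of_forall_notMem fun u _ => by
      rw [← hτ, Finset.card_eq_zero] at h0
      simpa [h0] using hQ u
    simp [hU]
  · have h3 : 2 * (U.filter fun u => ¬ P u).card ≤ U.card :=
      Nat.le_of_mul_le_mul_left (by linarith) h0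
    omega

end RandomSubset

namespace ClusterAlg

/-- An upper bound on the probability that a stage selects a bad set of centers. -/
noncomputable def stageFailure (n τ : ℕ) : ℝ := τ * (n : ℝ) ^ (-2 : ℝ) + (n : ℝ) ^ (-3 : ℝ)

theorem log_two_mul_logb (n : ℕ) : Real.log 2 * Real.logb 2 n = Real.log n := by
  rw [Real.logb, mul_div_cancel₀ _ (Real.log_pos one_lt_two).ne']

theorem one_le_logb {n : ℕ} (hn : 2 ≤ n) : 1 ≤ Real.logb 2 n := by
  rw [Real.le_logb_iff_rpow_le one_lt_two (by positivity), Real.rpow_one]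
  exact_mod_cast hn

theorem selProb_le_one (n τ m : ℕ) : selProb n τ m ≤ 1 := min_le_left _ _

theorem coe_selProb {n τ m : ℕ} (hn : 2 ≤ n) (hτ : 1 ≤ τ)
    (hm : 8 * (τ : ℝ) * Real.logb 2 n ≤ m) :
    (selProb n τ m : ℝ) = 4 * τ * Real.log n / m := by
  have hl := one_le_logb hn
  have hτ' : (1 : ℝ) ≤ τ := by exact_mod_cast hτ
  have hm0 : (0 : ℝ) < m := lt_of_lt_of_le (by positivity) hm
  have hlog : 0 ≤ Real.log n := Real.log_natCast_nonneg n
  have heq : 4 * Real.log 2 * τ * Real.logb 2 n / m = 4 * τ * Real.log n / m := by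
    rw [← log_two_mul_logb]
    ring
  rw [selProb, NNReal.coe_min, heq, Real.coe_toNNReal _ (by positivity), NNReal.coe_one,
    min_eq_right]
  rw [div_le_one hm0]
  refine le_trans ?_ hm
  have h2 : Real.log n ≤ Real.logb 2 n := by
    rw [← log_two_mul_logb]
    exact mul_le_of_le_one_left (by linarith) (by linarith [Real.log_two_lt_d9])
  nlinarith [mul_le_mul_of_nonneg_left h2 (by positivity : (0 : ℝ) ≤ τ)]

open Classical in
theorem tsum_randomSubset_not_good {V : Type*} [LinearOrder V] {U : Finset V} (f : V → V)
    {Q : Finset V} (hQ : ∀ u, f u ∈ Q) {n τ : ℕ} (hτ : Q.card = τ) (hn : 2 ≤ n) (hτ0 : 1 ≤ τ)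
    (hm : 8 * (τ : ℝ) * Real.logb 2 n ≤ U.card) :
    ∑' S, randomSubset U (selProb n τ U.card) (selProb_le_one n τ _) S *
      (if ¬ GoodSelection U f τ (7 * τ * Real.logb 2 n) S then 1 else 0) ≤
        ENNReal.ofReal (stageFailure n τ) := by
  rw [tsum_randomSubset_mul_ite]
  refine ENNReal.ofReal_le_ofReal ?_
  have hl := one_le_logb hn
  have hτ' : (1 : ℝ) ≤ τ := by exact_mod_cast hτ0
  have hm0 : (0 : ℝ) < U.card := lt_of_lt_of_le (by positivity) hm
  have hn1 : (1 : ℝ) ≤ n := by exact_mod_cast one_le_two.trans hn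
  have hn0 : (0 : ℝ) < n := by linarith
  have hp := coe_selProb hn hτ0 hm
  have hpm : (selProb n τ U.card : ℝ) * U.card = 4 * τ * Real.log n := by
    rw [hp]
    field_simp
  refine (sum_selWeight_not_good U f Q hQ hτ hτ0 (by exact_mod_cast hm0) (NNReal.coe_nonneg _)
    (by exact_mod_cast selProb_le_one n τ _) (7 * τ * Real.logb 2 n)).trans ?_
  rw [hpm, stageFailure]
  refine add_le_add (le_of_eq ?_) ?_
  · rw [Real.rpow_def_of_pos hn0]
    congr 2
    field_simp
    ring
  · rw [Real.rpow_def_of_pos two_pos, Real.rpow_def_of_pos hn0, ← Real.exp_add]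
    refine Real.exp_le_exp.2 ?_
    have : Real.log 2 * -(7 * τ * Real.logb 2 n) = -(7 * τ * Real.log n) := by
      rw [← log_two_mul_logb]
      ring
    rw [this]
    nlinarith [mul_le_mul_of_nonneg_right hτ' (Real.log_nonneg hn1)]

theorem stageFailure_mul_log_le {n τ : ℕ} (hn : 2 ≤ n) (hm : 8 * (τ : ℝ) * Real.logb 2 n ≤ n) :
    stageFailure n τ * Nat.log 2 n ≤ 1 / n := by
  have hn2 : (2 : ℝ) ≤ n := by exact_mod_cast hn
  have hlog : (Nat.log 2 n : ℝ) ≤ Real.logb 2 n := by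
    exact_mod_cast Real.natLog_le_logb n 2
  have hle : (Nat.log 2 n : ℝ) ≤ n := by exact_mod_cast Nat.log_le_self 2 n
  have e2 : (n : ℝ) ^ (-2 : ℝ) = ((n : ℝ) ^ 2)⁻¹ := by
    rw [Real.rpow_neg (by positivity)]
    norm_cast
  have e3 : (n : ℝ) ^ (-3 : ℝ) = ((n : ℝ) ^ 3)⁻¹ := by
    rw [Real.rpow_neg (by positivity)]
    norm_cast
  have h1 : τ * (Nat.log 2 n : ℝ) ≤ n / 8 := by
    have := mul_le_mul_of_nonneg_left hlog (Nat.cast_nonneg (α := ℝ) τ)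
    linarith
  rw [stageFailure, e2, e3]
  have : (τ * ((n : ℝ) ^ 2)⁻¹ + ((n : ℝ) ^ 3)⁻¹) * Nat.log 2 n =
      (τ * Nat.log 2 n * n + Nat.log 2 n) / (n : ℝ) ^ 3 := by
    field_simp
  rw [this, div_le_div_iff₀ (by positivity) (by positivity)]
  nlinarith [mul_le_mul_of_nonneg_right h1 (by positivity : (0 : ℝ) ≤ n * n),
    mul_le_mul_of_nonneg_right hle (by positivity : (0 : ℝ) ≤ n),
    mul_le_mul_of_nonneg_right hn2 (by positivity : (0 : ℝ) ≤ n * n)]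

end ClusterAlg

theorem WGraph.wdist_le_weight_add {V : Type*} {G : WGraph V} (hG : G.Connected) {u v w : V}
    (h : G.Adj u v) : G.wdist u w ≤ G.weight s(u, v) + G.wdist v w :=
  (G.wdist_triangle hG u v w).trans (Nat.add_le_add_right (G.wdist_le_weight h) _)

namespace ClusterAlg

section GrowStep

variable {V : Type*}

theorem dVal_of_eq_some {s : NodeStates V} {u : V} {x : ℕ × V} (h : s u = some x) :
    dVal s u = (x.1 : ℕ∞) := by
  simp [dVal, h]

theorem exists_of_dVal_le {s : NodeStates V} {u : V} {d : ℕ} (h : dVal s u ≤ d) :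
    ∃ d' c, s u = some (d', c) ∧ d' ≤ d := by
  rcases hs : s u with _ | ⟨d', c⟩
  · simp [dVal, hs] at h
  · rw [dVal_of_eq_some hs] at h
    exact ⟨d', c, rfl, by exact_mod_cast h⟩

variable [LinearOrder V] {E : Finset (V × V × ℕ)} {Δ : ℕ} {s : NodeStates V}

theorem mem_offers {v : V} {x : ℕ ×ₗ V} :
    x ∈ offers E Δ s v ↔ ∃ a w d c, (a, v, w) ∈ E ∧ s a = some (d, c) ∧ d < Δ ∧ w ≤ Δ ∧
      d + w ≤ Δ ∧ ((d + w : ℕ) : ℕ∞) < dVal s v ∧ x = toLex (d + w, c) := by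
  rw [offers, Finset.mem_biUnion]
  constructor
  · rintro ⟨⟨a, b, w⟩, he, hx⟩
    rcases hs : s a with _ | ⟨d, c⟩
    · simp [hs] at hx
    · simp only [hs] at hx
      split_ifs at hx with hc
      · obtain ⟨rfl, h1, h2, h3, h4⟩ := hc
        exact ⟨a, w, d, c, he, hs, h1, h2, h3, h4, Finset.mem_singleton.1 hx⟩
      · simp at hx
  · rintro ⟨a, w, d, c, he, hs, h1, h2, h3, h4, rfl⟩
    refine ⟨(a, v, w), he, ?_⟩
    simp only [hs]
    rw [if_pos ⟨trivial, h1, h2, h3, h4⟩]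
    exact Finset.mem_singleton_self _

theorem growStep_cases (v : V) : growStep E Δ s v = s v ∨
    ∃ a w d c, (a, v, w) ∈ E ∧ s a = some (d, c) ∧ d + w ≤ Δ ∧
      ((d + w : ℕ) : ℕ∞) < dVal s v ∧ growStep E Δ s v = some (d + w, c) := by
  by_cases h : (offers E Δ s v).Nonempty
  · right
    obtain ⟨a, w, d, c, he, hs, -, -, h3, h4, hx⟩ := mem_offers.1 ((offers E Δ s v).min'_mem h)
    refine ⟨a, w, d, c, he, hs, h3, h4, ?_⟩
    rw [growStep, dif_pos h, hx]
    rfl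
  · left
    rw [growStep, dif_neg h]

theorem dVal_growStep_le (v : V) : dVal (growStep E Δ s) v ≤ dVal s v := by
  rcases growStep_cases (E := E) (Δ := Δ) (s := s) v with h | ⟨a, w, d, c, -, -, -, hlt, h⟩
  · simp [dVal, h]
  · rw [dVal_of_eq_some h]
    exact hlt.le

theorem dVal_growStep_le_of_mem {a v c : V} {w d : ℕ} (he : (a, v, w) ∈ E)
    (hs : s a = some (d, c)) (hw : 0 < w) (hΔ : d + w ≤ Δ) :
    dVal (growStep E Δ s) v ≤ ((d + w : ℕ) : ℕ∞) := by
  by_cases hlt : ((d + w : ℕ) : ℕ∞) < dVal s v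
  · have hmem : toLex (d + w, c) ∈ offers E Δ s v :=
      mem_offers.2 ⟨a, w, d, c, he, hs, by omega, by omega, hΔ, hlt, rfl⟩
    have hmin := (offers E Δ s v).min'_le _ hmem
    have hg : growStep E Δ s v = some (ofLex ((offers E Δ s v).min' ⟨_, hmem⟩)) := by
      rw [growStep, dif_pos ⟨_, hmem⟩]
    rw [dVal_of_eq_some hg]
    rcases Prod.Lex.le_iff.1 hmin with h | h
    · exact_mod_cast h.le
    · exact_mod_cast h.1.le
  · exact (dVal_growStep_le v).trans (not_lt.1 hlt)

theorem mem_contractEdges {x : V × V × ℕ} :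
    x ∈ contractEdges E s ↔ ∃ a b w, (a, b, w) ∈ E ∧
      ((s a = none ∧ s b = none ∧ x = (a, b, w)) ∨
        (∃ d c, s a = some (d, c) ∧ s b = none ∧ x = (c, b, w)) ∨
        (∃ d c, s a = none ∧ s b = some (d, c) ∧ x = (a, c, w))) := by
  rw [contractEdges, Finset.mem_biUnion]
  constructor
  · rintro ⟨⟨a, b, w⟩, he, hx⟩
    refine ⟨a, b, w, he, ?_⟩
    rcases ha : s a with _ | ⟨d, c⟩ <;> rcases hb : s b with _ | ⟨d', c'⟩ <;>
      simp_all
  · rintro ⟨a, b, w, he, h⟩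
    refine ⟨(a, b, w), he, ?_⟩
    rcases h with ⟨ha, hb, rfl⟩ | ⟨d, c, ha, hb, rfl⟩ | ⟨d, c, ha, hb, rfl⟩ <;> simp [ha, hb]

end GrowStep

section Invariants

variable {V : Type*}

/-- `U` is the set of uncovered nodes, `C` the set of centers of the clusters built so far, and `E`
the edge set of the contracted graph.  Every covered node is assigned to a center at distance at
most `r`, and the edges of `E` leading to uncovered nodes are those of `G`, except that their other
end, if it is covered, is replaced by a center at distance at most `r` from it. -/
structure CoverInv (G : WGraph V) (U C : Finset V) (E : Finset (V × V × ℕ))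
    (assign : V → Option V) (r : ℕ) : Prop where
  notMem_of_mem_centers : ∀ u ∈ C, u ∉ U
  mem_of_edge : ∀ a b w, (a, b, w) ∈ E → (a ∈ C ∨ a ∈ U) ∧ (b ∈ C ∨ b ∈ U)
  of_edge : ∀ a b w, (a, b, w) ∈ E → b ∈ U →
    (a ∈ U ∧ G.Adj b a ∧ G.weight s(b, a) = w) ∨
      (a ∈ C ∧ ∃ a' ∉ U, G.wdist a a' ≤ r ∧ G.Adj b a' ∧ G.weight s(b, a') = w)
  edge_of_adj : ∀ a b, G.Adj b a → b ∈ U → a ∈ U → (a, b, G.weight s(b, a)) ∈ E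
  exists_edge_of_adj : ∀ a b, G.Adj b a → b ∈ U → a ∉ U → ∃ c ∈ C, (c, b, G.weight s(b, a)) ∈ E
  exists_assign : ∀ u ∉ U, ∃ c ∈ C, assign u = some c ∧ G.wdist c u ≤ r
  assign_center : ∀ c ∈ C, assign c = some c

/-- A node from which clusters can grow: covered in a previous stage, or selected as a center. -/
def IsSource (U X : Finset V) (y : V) : Prop := y ∉ U ∨ y ∈ X

/-- Soundness of the node states `s` during a stage with center set `X`. -/
structure StateInv (G : WGraph V) (U C X : Finset V) (Δ r : ℕ) (s : NodeStates V) : Prop where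
  centers_subset : C ⊆ X
  mem_of_mem : ∀ x ∈ X, x ∈ C ∨ x ∈ U
  state_center : ∀ x ∈ X, s x = some (0, x)
  sound : ∀ u d c, s u = some (d, c) → (u ∈ C ∨ u ∈ U) ∧ c ∈ X ∧ d ≤ Δ ∧
    G.wdist c u ≤ r + d ∧ ∃ y, IsSource U X y ∧ G.wdist u y ≤ d

/-- The states of all nodes with a minimum-weight path of at most `j` edges and weight at most `Δ`
to a nearest source are final. -/
def CompleteUpTo (G : WGraph V) (U X : Finset V) (Δ j : ℕ) (s : NodeStates V) : Prop :=
  ∀ u ∈ U, ∀ y, IsSource U X y → (∀ y', IsSource U X y' → G.wdist u y ≤ G.wdist u y') →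
    G.wdist u y ≤ Δ → ∀ p : G.toSimpleGraph.Walk u y, G.walkWeight p = G.wdist u y →
      p.length ≤ j → dVal s u ≤ (G.wdist u y : ℕ∞)

variable {G : WGraph V} {U C X : Finset V} {E : Finset (V × V × ℕ)} {assign : V → Option V}
  {Δ r : ℕ} {s : NodeStates V}

theorem exists_nearest_source {u y : V} (hy : IsSource U X y) :
    ∃ y₀, IsSource U X y₀ ∧ ∀ y', IsSource U X y' → G.wdist u y₀ ≤ G.wdist u y' := by
  have hne : {m | ∃ y, IsSource U X y ∧ G.wdist u y = m}.Nonempty := ⟨_, y, hy, rfl⟩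
  obtain ⟨y₀, h₀, he⟩ := Nat.sInf_mem hne
  exact ⟨y₀, h₀, fun y' hy' => he ▸ Nat.sInf_le ⟨y', hy', rfl⟩⟩

theorem StateInv.mono (h : StateInv G U C X Δ r s) {Δ' : ℕ} (hΔ : Δ ≤ Δ') :
    StateInv G U C X Δ' r s where
  centers_subset := h.centers_subset
  mem_of_mem := h.mem_of_mem
  state_center := h.state_center
  sound u d c hu := by
    obtain ⟨h1, h2, h3, h4⟩ := h.sound u d c hu
    exact ⟨h1, h2, h3.trans hΔ, h4⟩

theorem StateInv.completeUpTo_zero (h : StateInv G U C X Δ r s) : CompleteUpTo G U X Δ 0 s := by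
  intro u hu y hy _ _ p _ hl
  obtain rfl := SimpleGraph.Walk.eq_of_length_eq_zero (Nat.le_zero.1 hl)
  have hX : u ∈ X := hy.resolve_left (not_not.2 hu)
  simp [dVal_of_eq_some (h.state_center u hX)]

theorem StateInv.dVal_le_iff (h : StateInv G U C X Δ r s) (u : V) :
    dVal s u ≤ (Δ : ℕ∞) ↔ s u ≠ none := by
  rcases hs : s u with _ | ⟨d, c⟩
  · simp [dVal, hs]
  · simpa [dVal_of_eq_some hs] using (h.sound u d c hs).2.2.1

variable [LinearOrder V]

theorem StateInv.growStep (hG : G.Connected) (hc : CoverInv G U C E assign r)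
    (h : StateInv G U C X Δ r s) : StateInv G U C X Δ r (growStep E Δ s) where
  centers_subset := h.centers_subset
  mem_of_mem := h.mem_of_mem
  state_center x hx := by
    rcases growStep_cases (E := E) (Δ := Δ) (s := s) x with hs | ⟨_, _, _, _, _, _, _, hlt, _⟩
    · rw [hs, h.state_center x hx]
    · simp [dVal_of_eq_some (h.state_center x hx)] at hlt
  sound v d' c' hv := by
    rcases growStep_cases (E := E) (Δ := Δ) (s := s) v with
      hs | ⟨a, w, d, c, he, ha, hΔ, hlt, hs⟩
    · exact h.sound v d' c' (hs ▸ hv)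
    · rw [hs] at hv
      obtain ⟨rfl, rfl⟩ : d + w = d' ∧ c = c' := by simpa using hv
      have hvU : v ∈ U := by
        refine (hc.mem_of_edge a v w he).2.resolve_left fun hvC => ?_
        simp [dVal_of_eq_some (h.state_center v (h.centers_subset hvC))] at hlt
      obtain ⟨-, hcX, -, hca, y, hy, hya⟩ := h.sound a d c ha
      refine ⟨Or.inr hvU, hcX, hΔ, ?_⟩
      rcases hc.of_edge a v w he hvU with ⟨haU, hadj, hw⟩ | ⟨haC, a', ha', hr, hadj, hw⟩
      · have h1 := G.wdist_le_add_weight hG (u := c) hadj.symm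
        have h2 := G.wdist_le_weight_add hG (w := y) hadj
        rw [Sym2.eq_swap] at h1
        exact ⟨by omega, y, hy, by omega⟩
      · have hs' := h.state_center a (h.centers_subset haC)
        rw [ha] at hs'
        obtain ⟨rfl, rfl⟩ : d = 0 ∧ c = a := by simpa using hs'
        have h1 := G.wdist_le_add_weight hG (u := c) hadj.symm
        have h2 := G.wdist_le_weight hadj
        rw [Sym2.eq_swap] at h1
        exact ⟨by omega, a', Or.inl ha', by omega⟩

theorem CompleteUpTo.growStep (hG : G.Connected) (hc : CoverInv G U C E assign r)
    (h : StateInv G U C X Δ r s) {j : ℕ} (hj : CompleteUpTo G U X Δ j s) :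
    CompleteUpTo G U X Δ (j + 1) (growStep E Δ s) := by
  intro u hu y hy hmin hΔ p hp hl
  cases p with
  | nil =>
    exact (dVal_growStep_le u).trans
      (h.completeUpTo_zero u hu u hy hmin hΔ .nil (by simp) le_rfl)
  | @cons _ a _ hadj q =>
    rw [G.walkWeight_cons] at hp
    have hpos := G.weight_pos_of_adj hadj
    have hqa := G.wdist_le_walkWeight q
    have huy := G.wdist_le_weight_add hG (w := y) hadj
    by_cases ha : a ∈ U
    · have hmin' : ∀ y', IsSource U X y' → G.wdist a y ≤ G.wdist a y' := fun y' hy' => by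
        have h1 := hmin y' hy'
        have h2 := G.wdist_le_weight_add hG (w := y') hadj
        omega
      have hle := hj a ha y hy hmin' (by omega) q (by omega)
        (by rw [SimpleGraph.Walk.length_cons] at hl; omega)
      obtain ⟨d, c, hs, hd⟩ := exists_of_dVal_le hle
      refine (dVal_growStep_le_of_mem (hc.edge_of_adj a u hadj hu ha) hs hpos (by omega)).trans ?_
      exact_mod_cast (by omega : d + G.weight s(u, a) ≤ G.wdist u y)
    · obtain ⟨c, hcC, he⟩ := hc.exists_edge_of_adj a u hadj hu ha
      refine (dVal_growStep_le_of_mem he (h.state_center c (h.centers_subset hcC)) hpos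
        (by omega)).trans ?_
      exact_mod_cast (by omega : 0 + G.weight s(u, a) ≤ G.wdist u y)

theorem growStep_eq_self (hG : G.Connected) (hc : CoverInv G U C E assign r)
    (h : StateInv G U C X Δ r s) {j L Δ' : ℕ} (hj : CompleteUpTo G U X Δ j s)
    (hL : G.HopBound Δ' L) (hΔ' : Δ ≤ Δ') (hjL : L ≤ j) : growStep E Δ s = s := by
  funext v
  rcases growStep_cases (E := E) (Δ := Δ) (s := s) v with hs | ⟨a, w, d, c, he, ha, hΔ, hlt, hs⟩
  · exact hs
  · exfalso
    have hvU : v ∈ U := by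
      refine (hc.mem_of_edge a v w he).2.resolve_left fun hvC => ?_
      simp [dVal_of_eq_some (h.state_center v (h.centers_subset hvC))] at hlt
    obtain ⟨-, -, -, -, y, hy, hyv⟩ := (h.growStep hG hc).sound v _ _ hs
    obtain ⟨y₀, hy₀, hmin⟩ := exists_nearest_source (G := G) (u := v) hy
    have h1 := hmin y hy
    obtain ⟨p, hp, hl⟩ := hL v y₀ (by omega)
    have h2 := hj v hvU y₀ hy₀ hmin (by omega) p hp (hl.trans hjL)
    exact absurd (hlt.trans_le h2) (by exact_mod_cast (by omega : ¬ d + w < G.wdist v y₀))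

theorem dVal_le_of_growStep_eq_self (hG : G.Connected) (hc : CoverInv G U C E assign r)
    (h : StateInv G U C X Δ r s) (hs : growStep E Δ s = s) {u y : V} (hu : u ∈ U)
    (hy : IsSource U X y) (hd : G.wdist u y ≤ Δ) : dVal s u ≤ (Δ : ℕ∞) := by
  have hcomp : ∀ j, CompleteUpTo G U X Δ j s := by
    intro j
    induction j with
    | zero => exact h.completeUpTo_zero
    | succ j ih => simpa [hs] using ih.growStep hG hc h
  obtain ⟨y₀, hy₀, hmin⟩ := exists_nearest_source (G := G) (u := u) hy
  obtain ⟨p, hp⟩ := G.exists_walkWeight_eq_wdist hG u y₀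
  have h1 := (hmin y hy).trans hd
  exact (hcomp _ u hu y₀ hy₀ hmin h1 p hp le_rfl).trans (by exact_mod_cast h1)

theorem CoverInv.contract (hc : CoverInv G U C E assign r) (h : StateInv G U C X Δ r s) {r' : ℕ}
    (hr : r + Δ ≤ r') :
    CoverInv G (U.filter fun u => s u = none) X (contractEdges E s)
      (fun u => if u ∈ U.filter (fun u => dVal s u ≤ (Δ : ℕ∞)) then (s u).map Prod.snd
        else assign u) r' := by
  have hmemU : ∀ u, (u ∈ C ∨ u ∈ U) → s u = none → u ∈ U := fun u hu hs =>
    hu.resolve_left fun huC => by simp [h.state_center u (h.centers_subset huC)] at hs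
  have hstate : ∀ a ∈ C, ∀ d c, s a = some (d, c) → c = a := fun a ha d c hs => by
    rw [h.state_center a (h.centers_subset ha)] at hs
    simp_all
  have hsome : ∀ a, s a ≠ none → ∃ d c, s a = some (d, c) := fun a ha => by
    obtain ⟨⟨d, c⟩, hs⟩ := Option.ne_none_iff_exists'.1 ha
    exact ⟨d, c, hs⟩
  constructor
  · intro u hu hu'
    rw [Finset.mem_filter, h.state_center u hu] at hu'
    simp at hu'
  · intro a b w he
    simp only [Finset.mem_filter]
    obtain ⟨a₀, b₀, w₀, he₀, ⟨ha, hb, heq⟩ | ⟨d, c, ha, hb, heq⟩ | ⟨d, c, ha, hb, heq⟩⟩ :=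
      mem_contractEdges.1 he <;>
    obtain ⟨rfl, rfl, rfl⟩ : a = _ ∧ b = _ ∧ w = _ := by simpa using heq
    · obtain ⟨h1, h2⟩ := hc.mem_of_edge _ _ _ he₀
      exact ⟨.inr ⟨hmemU _ h1 ha, ha⟩, .inr ⟨hmemU _ h2 hb, hb⟩⟩
    · exact ⟨.inl (h.sound _ _ _ ha).2.1, .inr ⟨hmemU _ (hc.mem_of_edge _ _ _ he₀).2 hb, hb⟩⟩
    · exact ⟨.inr ⟨hmemU _ (hc.mem_of_edge _ _ _ he₀).1 ha, ha⟩, .inl (h.sound _ _ _ hb).2.1⟩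
  · intro a b w he hbU
    simp only [Finset.mem_filter] at hbU ⊢
    obtain ⟨a₀, b₀, w₀, he₀, ⟨ha, hb, heq⟩ | ⟨d, c, ha, hb, heq⟩ | ⟨d, c, ha, hb, heq⟩⟩ :=
      mem_contractEdges.1 he <;>
    obtain ⟨rfl, rfl, rfl⟩ : a = _ ∧ b = _ ∧ w = _ := by simpa using heq
    · rcases hc.of_edge _ _ _ he₀ hbU.1 with ⟨h1, h2⟩ | ⟨h1, -⟩
      · exact .inl ⟨⟨h1, ha⟩, h2⟩
      · simp [h.state_center _ (h.centers_subset h1)] at ha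
    · right
      obtain ⟨-, hcX, hd, hcu, -⟩ := h.sound _ _ _ ha
      refine ⟨hcX, ?_⟩
      rcases hc.of_edge _ _ _ he₀ hbU.1 with ⟨h1, h2⟩ | ⟨h1, a', ha', hra, h2⟩
      · exact ⟨a₀, by simp [ha], by omega, h2⟩
      · obtain rfl := hstate _ h1 _ _ ha
        exact ⟨a', fun hcon => ha' hcon.1, by omega, h2⟩
    · rw [h.state_center _ (h.sound _ _ _ hb).2.1] at hbU
      simp at hbU
  · intro a b hadj hb ha
    rw [Finset.mem_filter] at ha hb
    exact mem_contractEdges.2 ⟨a, b, _, hc.edge_of_adj a b hadj hb.1 ha.1, .inl ⟨ha.2, hb.2, rfl⟩⟩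
  · intro a b hadj hb ha
    rw [Finset.mem_filter] at ha hb
    by_cases haU : a ∈ U
    · obtain ⟨d, c, hs⟩ := hsome a fun h0 => ha ⟨haU, h0⟩
      exact ⟨c, (h.sound _ _ _ hs).2.1, mem_contractEdges.2
        ⟨a, b, _, hc.edge_of_adj a b hadj hb.1 haU, .inr (.inl ⟨d, c, hs, hb.2, rfl⟩)⟩⟩
    · obtain ⟨c, hcC, he⟩ := hc.exists_edge_of_adj a b hadj hb.1 haU
      exact ⟨c, h.centers_subset hcC, mem_contractEdges.2 ⟨c, b, _, he,
        .inr (.inl ⟨0, c, h.state_center c (h.centers_subset hcC), hb.2, rfl⟩)⟩⟩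
  · intro u hu
    by_cases huU : u ∈ U
    · obtain ⟨d, c, hs⟩ := hsome u fun h0 => hu (Finset.mem_filter.2 ⟨huU, h0⟩)
      obtain ⟨-, hcX, hd, hcu, -⟩ := h.sound _ _ _ hs
      refine ⟨c, hcX, ?_, by omega⟩
      rw [if_pos (Finset.mem_filter.2 ⟨huU, (h.dVal_le_iff u).2 (by simp [hs])⟩), hs]
      rfl
    · obtain ⟨c, hcC, hcu, hd⟩ := hc.exists_assign u huU
      refine ⟨c, h.centers_subset hcC, ?_, by omega⟩
      rw [if_neg fun hcon => huU (Finset.mem_filter.1 hcon).1, hcu]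
  · intro x hx
    have hs := h.state_center x hx
    by_cases hxU : x ∈ U
    · rw [if_pos (Finset.mem_filter.2 ⟨hxU, (h.dVal_le_iff x).2 (by simp [hs])⟩), hs]
      rfl
    · rw [if_neg fun hcon => hxU (Finset.mem_filter.1 hcon).1]
      exact hc.assign_center x ((h.mem_of_mem x hx).resolve_right hxU)

end Invariants

end ClusterAlg

section MarkovChain

theorem PMF.tsum_bind_mul {α β : Type*} (p : PMF α) (f : α → PMF β) (g : β → ℝ≥0∞) :
    ∑' b, (p.bind f) b * g b = ∑' a, p a * ∑' b, f a b * g b := by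
  simp_rw [PMF.bind_apply, ← ENNReal.tsum_mul_right, ← ENNReal.tsum_mul_left]
  rw [ENNReal.tsum_comm]
  simp_rw [mul_assoc]

theorem PMF.tsum_pure_mul {α : Type*} (a : α) (g : α → ℝ≥0∞) :
    ∑' b, (PMF.pure a) b * g b = g a := by
  rw [tsum_eq_single a fun b hb => by simp [PMF.pure_apply, hb]]
  simp [PMF.pure_apply]

theorem PMF.tsum_map_mul {α β : Type*} (p : PMF α) (f : α → β) (g : β → ℝ≥0∞) :
    ∑' b, (p.map f) b * g b = ∑' a, p a * g (f a) := by
  rw [PMF.map, PMF.tsum_bind_mul]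
  exact tsum_congr fun a => by rw [Function.comp_apply, PMF.tsum_pure_mul]

theorem PMF.tsum_mul_le {α : Type*} (p : PMF α) {g : α → ℝ≥0∞} {x : ℝ≥0∞} (h : ∀ a, g a ≤ x) :
    ∑' a, p a * g a ≤ x := by
  calc ∑' a, p a * g a ≤ ∑' a, p a * x := ENNReal.tsum_le_tsum fun a => by gcongr; exact h a
    _ = x := by rw [ENNReal.tsum_mul_right, p.tsum_coe, one_mul]

open Classical in
/-- Along a Markov chain, the probability that an invariant fails is at most the initial value of
any cost function whose expectation, failure being charged `1`, does not increase. -/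
theorem PMF.tsum_invariant_le {α : Type*} (κ : α → PMF α) (μ : ℕ → PMF α)
    (hμ : ∀ N, μ (N + 1) = (μ N).bind κ) (a₀ : α) (h0 : μ 0 = PMF.pure a₀) (I : ℕ → α → Prop)
    (cost : α → ℝ≥0∞) (hI : I 0 a₀)
    (hstep : ∀ N a, I N a → ∑' b, κ a b * (if I (N + 1) b then cost b else 1) ≤ cost a) (N : ℕ) :
    ∑' a, μ N a * (if I N a then 0 else 1) ≤ cost a₀ := by
  have key : ∀ N, ∑' a, μ N a * (if I N a then min 1 (cost a) else 1) ≤ cost a₀ := by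
    intro N
    induction N with
    | zero =>
      rw [h0, PMF.tsum_pure_mul, if_pos hI]
      exact min_le_right _ _
    | succ N ih =>
      rw [hμ, PMF.tsum_bind_mul]
      refine (ENNReal.tsum_le_tsum fun a => ?_).trans ih
      gcongr
      have h1 : ∑' b, κ a b * (if I (N + 1) b then min 1 (cost b) else 1) ≤ 1 :=
        (κ a).tsum_mul_le fun b => by split_ifs <;> simp
      split_ifs with ha
      · refine le_min h1 ((ENNReal.tsum_le_tsum fun b => ?_).trans (hstep N a ha))
        gcongr
        split_ifs <;> simp
      · exact h1
  refine (ENNReal.tsum_le_tsum fun a => ?_).trans (key N)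
  gcongr
  split_ifs <;> simp

open Classical in
theorem PMF.one_sub_le_toOuterMeasure {α : Type*} (p : PMF α) {I : α → Prop} {s : Set α}
    (hs : ∀ a, I a → a ∈ s) {x : ℝ≥0∞} (hx : ∑' a, p a * (if I a then 0 else 1) ≤ x) :
    1 - x ≤ p.toOuterMeasure s := by
  rw [tsub_le_iff_right, ← p.tsum_coe]
  refine le_trans ?_ (add_le_add_right hx _)
  rw [PMF.toOuterMeasure_apply, ← ENNReal.tsum_add]
  refine ENNReal.tsum_le_tsum fun a => ?_
  by_cases ha : I a
  · simp [Set.indicator_of_mem (hs a ha)]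
  · simp [ha]

end MarkovChain

namespace ClusterAlg

variable {V : Type*} [LinearOrder V] {G : WGraph V} {n τ R L N : ℕ} {c : Config V}

/-- The part of the invariant of an execution that holds inside and between stages: `i` stages have
been completed and `Δ` has been doubled `m` times. -/
structure BaseInv (G : WGraph V) (n τ R i m : ℕ) (c : Config V) : Prop where
  cover : CoverInv G c.uncovered c.centers c.edges c.assign (4 * R * i)
  card_centers : (c.centers.card : ℝ) ≤ i * (7 * τ * Real.logb 2 n)
  delta_eq : c.Δ = G.minWeight * 2 ^ m
  delta_le : c.Δ ≤ 4 * R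
  trace_le : ∀ x ∈ c.trace, x ≤ 4 * R
  stages_le : i + Nat.log 2 c.uncovered.card ≤ Nat.log 2 n

/-- The invariant at the test of the outer loop after `N` transitions; `L` bounds the number of
edges of minimum-weight paths of weight at most `4R`. -/
def OuterInv (G : WGraph V) (n τ R L N : ℕ) (c : Config V) : Prop :=
  c.phase = .outer ∧ ∃ i m, BaseInv G n τ R i m c ∧ c.trace.length ≤ (i + m) * (L + 1) ∧
    N ≤ c.trace.length + i

open Classical in
/-- The invariant within a stage after `N` transitions. -/
def GrowInv (G : WGraph V) (n τ R L N : ℕ) (c : Config V) : Prop :=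
  c.phase = .grow ∧ 2 ≤ c.uncovered.card ∧
    c.uncovered.card ≤ 2 * (c.uncovered.filter fun u => ∃ x ∈ c.X, G.wdist u x ≤ 2 * R).card ∧
    ∃ i m j, BaseInv G n τ R i m c ∧
      StateInv G c.uncovered c.centers c.X c.Δ (4 * R * i) c.state ∧
      CompleteUpTo G c.uncovered c.X c.Δ j c.state ∧ j ≤ L ∧
      (c.X.card : ℝ) ≤ (i + 1) * (7 * τ * Real.logb 2 n) ∧
      c.trace.length ≤ (i + m) * (L + 1) + j ∧ N ≤ c.trace.length + i + 1

theorem uncovered_endStage {s : NodeStates V} {r : ℕ}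
    (h : StateInv G c.uncovered c.centers c.X c.Δ r s) :
    (endStage c s).uncovered = c.uncovered.filter fun u => s u = none := by
  ext u
  simp only [Config.uncovered, endStage, Finset.mem_sdiff, Finset.mem_union, Finset.mem_filter]
  constructor
  · rintro ⟨h1 | h1, h2⟩
    · exact absurd h1 h2
    · exact ⟨⟨h1.1, fun hu => h2 (h.centers_subset hu)⟩, h1.2⟩
  · rintro ⟨⟨h1, -⟩, h2⟩
    exact ⟨.inr ⟨h1, h2⟩, fun hu => by simp [h.state_center u hu] at h2⟩

theorem card_uncovered_endStage {s : NodeStates V} {r : ℕ}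
    (h : StateInv G c.uncovered c.centers c.X c.Δ r s) :
    (reached c s).card + (endStage c s).uncovered.card = c.uncovered.card := by
  have hr : reached c s = c.uncovered.filter fun u => ¬ s u = none :=
    Finset.filter_congr fun u _ => h.dVal_le_iff u
  rw [uncovered_endStage h, hr, add_comm]
  exact Finset.card_filter_add_card_filter_not _

theorem GrowInv.growNext [Fintype V] (hG : G.Connected) (hL : G.HopBound (4 * R) L)
    (h : GrowInv G n τ R L N c) :
    (OuterInv G n τ R L (N + 1) (growNext c) ∧
      Nat.log 2 (growNext c).uncovered.card ≤ Nat.log 2 c.uncovered.card - 1) ∨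
    (GrowInv G n τ R L (N + 1) (growNext c) ∧
      (growNext c).uncovered.card = c.uncovered.card) := by
  obtain ⟨hph, hU2, hhit, i, m, j, hb, hst, hcomp, hjL, hX, htr, hN⟩ := h
  have hst' := hst.growStep hG hb.cover
  have hcomp' := hcomp.growStep hG hb.cover hst
  have htrace : ∀ x ∈ c.Δ :: c.trace, x ≤ 4 * R := fun x hx => by
    rcases List.mem_cons.1 hx with rfl | hx
    · exact hb.delta_le
    · exact hb.trace_le x hx
  set s := growStep c.edges c.Δ c.state with hs
  unfold ClusterAlg.growNext
  simp only [← hs]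
  split_ifs with h1 h2
  · left
    set c₁ : Config V := { c with trace := c.Δ :: c.trace } with hc₁
    have hst₁ : StateInv G c₁.uncovered c₁.centers c₁.X c₁.Δ (4 * R * i) s := hst'
    have hcard := card_uncovered_endStage (c := c₁) hst₁
    have hlog : Nat.log 2 (endStage c₁ s).uncovered.card ≤ Nat.log 2 c.uncovered.card - 1 := by
      rw [← Nat.log_div_base]
      refine Nat.log_mono_right ?_
      have e1 : c₁.uncovered.card = c.uncovered.card := rfl
      have e2 : (reached c₁ s).card = (reached c s).card := rfl
      omega
    have hpos : 0 < Nat.log 2 c.uncovered.card := Nat.log_pos one_lt_two hU2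
    have hstages := hb.stages_le
    refine ⟨⟨rfl, i + 1, m, ⟨?_, ?_, hb.delta_eq, hb.delta_le, htrace, by omega⟩, ?_, ?_⟩, hlog⟩
    · rw [uncovered_endStage (c := c₁) hst₁]
      exact hb.cover.contract hst' (by rw [mul_add, mul_one]; linarith [hb.delta_le])
    · push_cast
      exact hX
    · have : (endStage c₁ s).trace.length = c.trace.length + 1 := rfl
      rw [this]
      linarith
    · have : (endStage c₁ s).trace.length = c.trace.length + 1 := rfl
      omega
  · right
    have hΔ : c.Δ < 2 * R := by
      by_contra! hcon
      refine h1 (hhit.trans (Nat.mul_le_mul_left _ (Finset.card_le_card fun u hu => ?_)))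
      obtain ⟨hu, x, hx, hd⟩ := Finset.mem_filter.1 hu
      rw [h2]
      exact Finset.mem_filter.2 ⟨hu, dVal_le_of_growStep_eq_self hG hb.cover hst h2 hu
        (.inr hx) (hd.trans hcon)⟩
    have hst₂ : StateInv G c.uncovered c.centers c.X (2 * c.Δ) (4 * R * i) c.state :=
      hst.mono (by omega)
    refine ⟨⟨hph, hU2, hhit, i, m + 1, 0, ⟨hb.cover, hb.card_centers, ?_, ?_,
      htrace, hb.stages_le⟩, hst₂, hst₂.completeUpTo_zero, Nat.zero_le _, hX, ?_, ?_⟩, rfl⟩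
    · change 2 * c.Δ = _
      rw [hb.delta_eq, pow_succ]
      ring
    · change 2 * c.Δ ≤ _
      omega
    · change c.trace.length + 1 ≤ _
      linarith
    · change _ ≤ c.trace.length + 1 + _ + _
      omega
  · right
    have hj : j < L := by
      by_contra! hcon
      exact h2 (growStep_eq_self hG hb.cover hst hcomp hL hb.delta_le hcon)
    refine ⟨⟨hph, hU2, hhit, i, m, j + 1, ⟨hb.cover, hb.card_centers,
      hb.delta_eq, hb.delta_le, htrace, hb.stages_le⟩, hst', hcomp', hj, hX, ?_, ?_⟩, rfl⟩
    · change c.trace.length + 1 ≤ _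
      omega
    · change _ ≤ c.trace.length + 1 + _ + _
      omega

theorem OuterInv.startStage (hG : G.Connected) (h : OuterInv G n τ R L N c) (hn : 2 ≤ n)
    (hτ : 1 ≤ τ) (hU : 8 * (τ : ℝ) * Real.logb 2 n ≤ c.uncovered.card) {f : V → V} {Q : Finset V}
    (hQ : ∀ u, f u ∈ Q) (hQτ : Q.card = τ) (hf : ∀ u, G.wdist (f u) u ≤ R) {S : Finset V}
    (hS : GoodSelection c.uncovered f τ (7 * τ * Real.logb 2 n) S) :
    GrowInv G n τ R L (N + 1) (startStage c S) := by
  classical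
  obtain ⟨-, i, m, hb, htr, hN⟩ := h
  have hst : StateInv G c.uncovered c.centers (c.centers ∪ S) c.Δ (4 * R * i)
      fun u => if u ∈ c.centers ∪ S then some (0, u) else none := by
    have hmem : ∀ x ∈ c.centers ∪ S, x ∈ c.centers ∨ x ∈ c.uncovered := fun x hx =>
      (Finset.mem_union.1 hx).imp_right fun hxS => hS.1 hxS
    refine ⟨Finset.subset_union_left, hmem, fun x hx => if_pos hx, fun u d x hu => ?_⟩
    by_cases huX : u ∈ c.centers ∪ S
    · rw [if_pos huX] at hu
      obtain ⟨rfl, rfl⟩ : 0 = d ∧ u = x := by simpa using hu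
      exact ⟨hmem u huX, huX, Nat.zero_le _, by simp, u, .inr huX, by simp⟩
    · simp [huX] at hu
  refine ⟨rfl, ?_, ?_, i, m, 0, ⟨hb.cover, hb.card_centers, hb.delta_eq,
    hb.delta_le, hb.trace_le, hb.stages_le⟩, hst, hst.completeUpTo_zero, Nat.zero_le _, ?_, htr, ?_⟩
  · change 2 ≤ c.uncovered.card
    have h1 := one_le_logb hn
    have h2 : (1 : ℝ) ≤ τ := by exact_mod_cast hτ
    have : (2 : ℝ) ≤ c.uncovered.card := by nlinarith
    exact_mod_cast this
  · refine le_two_mul_card_of_goodSelection hQ hQτ hS fun u _ x hx hxu =>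
      ⟨x, Finset.mem_union_right _ hx, ?_⟩
    have h1 := G.wdist_triangle hG u (f u) x
    have h2 := hf u
    have h3 := hf x
    rw [hxu] at h3
    rw [G.wdist_comm hG u (f u)] at h1
    omega
  · change ((c.centers ∪ S).card : ℝ) ≤ _
    have h1 : ((c.centers ∪ S).card : ℝ) ≤ c.centers.card + S.card := by
      exact_mod_cast Finset.card_union_le _ _
    linarith [hb.card_centers, hS.2.1]
  · change _ ≤ c.trace.length + _ + _
    omega

/-- The conclusion of the theorem for a final configuration. -/
def Successful [Fintype V] (G : WGraph V) (n τ : ℕ) (C : ℝ) (out : Config V) : Prop :=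
  (∃ K : Clustering V,
    (∀ v, out.assign v = some (K.centerOf v)) ∧
    (K.numClusters : ℝ) ≤ C * τ * Real.logb 2 n ^ 2 ∧
    (K.radius G : ℝ) ≤ C * optRadius G τ * Real.logb 2 n) ∧
  (out.trace.length : ℝ) ≤ C * G.ell (optRadius G τ) * Real.logb 2 n ∧
  (∀ Δ ∈ out.trace, (Δ : ℝ) ≤ C * optRadius G τ)

theorem BaseInv.exists_clustering [Fintype V] {i m : ℕ} (hb : BaseInv G n τ R i m c) :
    ∃ K : Clustering V, (∀ v, (finish c).assign v = some (K.centerOf v)) ∧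
      K.numClusters ≤ c.centers.card + c.uncovered.card ∧ K.radius G ≤ 4 * R * i := by
  classical
  have hex : ∀ u, ∃ x, (u ∈ c.uncovered → x = u) ∧
      (u ∉ c.uncovered → x ∈ c.centers ∧ c.assign u = some x ∧ G.wdist x u ≤ 4 * R * i) := by
    intro u
    by_cases hu : u ∈ c.uncovered
    · exact ⟨u, fun _ => rfl, fun h => absurd hu h⟩
    · obtain ⟨x, hx⟩ := hb.cover.exists_assign u hu
      exact ⟨x, fun h => absurd h hu, fun _ => hx⟩
  choose f hf1 hf2 using hex
  refine ⟨⟨f, fun v => ?_⟩, fun v => ?_, ?_, Finset.sup_le fun v _ => ?_⟩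
  · by_cases hv : v ∈ c.uncovered
    · rw [hf1 v hv, hf1 v hv]
    · obtain ⟨h1, -, -⟩ := hf2 v hv
      obtain ⟨-, h2, -⟩ := hf2 (f v) (hb.cover.notMem_of_mem_centers _ h1)
      rw [hb.cover.assign_center _ h1] at h2
      exact (Option.some.inj h2).symm
  · by_cases hv : v ∈ c.uncovered
    · simp [finish, hv, hf1 v hv]
    · simp [finish, hv, (hf2 v hv).2.1]
  · rw [Clustering.numClusters_eq_card_image]
    refine (Finset.card_le_card fun x hx => ?_).trans (Finset.card_union_le _ _)
    obtain ⟨v, -, rfl⟩ := Finset.mem_image.1 hx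
    by_cases hv : v ∈ c.uncovered
    · exact Finset.mem_union_right _ (by simpa [hf1 v hv] using hv)
    · exact Finset.mem_union_left _ (hf2 v hv).1
  · by_cases hv : v ∈ c.uncovered
    · simp [hf1 v hv]
    · exact (hf2 v hv).2.2

theorem OuterInv.finish [Fintype V] {k ℓ : ℕ} (h : OuterInv G n τ R L N c) (hn : 2 ≤ n)
    (hU : (c.uncovered.card : ℝ) < 8 * (τ : ℝ) * Real.logb 2 n) (hR : optRadius G τ = R)
    (hℓ : G.ell R = ℓ) (hℓ1 : 1 ≤ ℓ) (hL : L = 8 * ℓ) (hmin : 0 < G.minWeight)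
    (hRn : R ≤ n ^ (k + 1)) : Successful G n τ (9 * k + 51) (finish c) := by
  obtain ⟨-, i, m, hb, htr, -⟩ := h
  obtain ⟨K, hK, hcard, hrad⟩ := hb.exists_clustering
  have hlog1 := one_le_logb hn
  have hi : (i : ℝ) ≤ Real.logb 2 n := by
    have h1 : (i : ℝ) ≤ Nat.log 2 n := by exact_mod_cast (by have := hb.stages_le; omega)
    exact h1.trans (by exact_mod_cast Real.natLog_le_logb n 2)
  have hm : (m : ℝ) ≤ (k + 3) * Real.logb 2 n := by
    have h1 : 2 ^ m ≤ 4 * n ^ (k + 1) := by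
      have h2 := hb.delta_eq ▸ hb.delta_le
      nlinarith [Nat.one_le_two_pow (n := m)]
    have h2 : ((2 : ℝ) ^ m) ≤ 4 * (n : ℝ) ^ (k + 1) := by exact_mod_cast h1
    have hn0 : (n : ℝ) ≠ 0 := by
      have : n ≠ 0 := by omega
      exact_mod_cast this
    have h3 := Real.logb_le_logb_of_le one_lt_two (by positivity) h2
    have h4 : Real.logb 2 4 = 2 := by
      rw [show (4 : ℝ) = 2 ^ 2 by norm_num, Real.logb_pow, Real.logb_self_eq_one one_lt_two]
      norm_num
    rw [Real.logb_mul (by norm_num) (by positivity), Real.logb_pow, Real.logb_pow,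
      Real.logb_self_eq_one one_lt_two, h4] at h3
    push_cast at h3
    linarith
  have hk0 : (0 : ℝ) ≤ k := Nat.cast_nonneg k
  have hτ0 : (0 : ℝ) ≤ τ := Nat.cast_nonneg τ
  have hR0 : (0 : ℝ) ≤ R := Nat.cast_nonneg R
  have hlog0 : 0 ≤ Real.logb 2 n := by linarith
  refine ⟨⟨K, hK, ?_, ?_⟩, ?_, fun x hx => ?_⟩
  · have h1 : (K.numClusters : ℝ) ≤ c.centers.card + c.uncovered.card := by exact_mod_cast hcard
    have h2 := mul_le_mul_of_nonneg_right hi (by positivity : 0 ≤ 7 * τ * Real.logb 2 n)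
    have h3 := mul_le_mul_of_nonneg_left hlog1 (by positivity : 0 ≤ 8 * τ * Real.logb 2 n)
    have h4 : 0 ≤ (9 * k + 36) * (τ * Real.logb 2 n ^ 2) := by positivity
    have h5 := hb.card_centers
    nlinarith
  · have h1 : (K.radius G : ℝ) ≤ 4 * R * i := by exact_mod_cast hrad
    have h2 := mul_le_mul_of_nonneg_left hi (by positivity : (0 : ℝ) ≤ 4 * R)
    have h3 : 0 ≤ (9 * k + 47) * (R * Real.logb 2 n) := by positivity
    rw [hR]
    nlinarith
  · have h1 : (c.trace.length : ℝ) ≤ (i + m) * (8 * ℓ + 1) := by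
      rw [hL] at htr
      exact_mod_cast htr
    have hℓ' : (1 : ℝ) ≤ ℓ := by exact_mod_cast hℓ1
    have h2 : ((i : ℝ) + m) * (8 * ℓ + 1) ≤ ((k + 4) * Real.logb 2 n) * (9 * ℓ) :=
      mul_le_mul (by linarith) (by linarith) (by positivity) (by positivity)
    have h3 : 0 ≤ 15 * (ℓ * Real.logb 2 n) := by positivity
    rw [hR, hℓ]
    change (c.trace.length : ℝ) ≤ _
    nlinarith
  · have h1 : (x : ℝ) ≤ 4 * R := by exact_mod_cast hb.trace_le x hx
    rw [hR]
    nlinarith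

/-- The invariant of an execution after `N` transitions. -/
def Inv [Fintype V] (G : WGraph V) (n τ R L : ℕ) (C : ℝ) (N : ℕ) (c : Config V) : Prop :=
  OuterInv G n τ R L N c ∨ GrowInv G n τ R L N c ∨ (c.phase = .done ∧ Successful G n τ C c)

/-- An upper bound on the number of selections of centers to come. -/
def stagesLeft (c : Config V) : ℕ :=
  match c.phase with
  | .outer => Nat.log 2 c.uncovered.card
  | .grow => Nat.log 2 c.uncovered.card - 1
  | .done => 0

theorem outerInv_init [Fintype V] (hn : Fintype.card V = n) (hR : G.minWeight ≤ R) :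
    OuterInv G n τ R L 0 (init G) := by
  classical
  have hU : (init G).uncovered = Finset.univ := by simp [Config.uncovered, init]
  have hE : ∀ a b w, (a, b, w) ∈ (init G).edges ↔ G.Adj b a ∧ G.weight s(b, a) = w := by
    intro a b w
    simp only [init, WGraph.edgeTriples, Finset.mem_image, Finset.mem_filter, Finset.mem_univ,
      true_and, Prod.exists, Prod.mk.injEq]
    constructor
    · rintro ⟨x, y, h, rfl, rfl, rfl⟩
      exact ⟨h.symm, by rw [Sym2.eq_swap]⟩
    · rintro ⟨h, rfl⟩
      exact ⟨a, b, h.symm, rfl, rfl, by rw [Sym2.eq_swap]⟩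
  refine ⟨rfl, 0, 0, ⟨⟨?_, ?_, ?_, ?_, ?_, ?_, ?_⟩, ?_, ?_, ?_, ?_, ?_⟩, by simp [init], by simp⟩
  · intro u hu
    simp [init] at hu
  · intro a b w _
    simp [hU]
  · intro a b w he _
    exact .inl ⟨by simp [hU], (hE a b w).1 he⟩
  · intro a b h _ _
    exact (hE _ _ _).2 ⟨h, rfl⟩
  · intro a b _ _ h
    simp [hU] at h
  · intro u hu
    simp [hU] at hu
  · intro u hu
    simp [init] at hu
  · simp [init]
  · simp [init]
  · change G.minWeight ≤ _
    omega
  · simp [init]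
  · simp [hU, hn]

open Classical in
theorem tsum_step_le [Fintype V] {k ℓ : ℕ} (hG : G.Connected) (hn : 2 ≤ n)
    (hτ : 1 ≤ τ) (hR : optRadius G τ = R) (hℓ : G.ell R = ℓ) (hℓ1 : 1 ≤ ℓ) (hL : L = 8 * ℓ)
    (hLhop : G.HopBound (4 * R) L) (hmin : 0 < G.minWeight) (hRn : R ≤ n ^ (k + 1))
    {f : V → V} {Q : Finset V} (hQ : ∀ u, f u ∈ Q) (hQτ : Q.card = τ)
    (hf : ∀ u, G.wdist (f u) u ≤ R) (hc : Inv G n τ R L (9 * k + 51) N c) :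
    ∑' b, step n τ c b * (if Inv G n τ R L (9 * k + 51) (N + 1) b then
      ENNReal.ofReal (stageFailure n τ) * stagesLeft b else 1) ≤
        ENNReal.ofReal (stageFailure n τ) * stagesLeft c := by
  rcases hc with h | h | ⟨hph, h⟩
  · have hph := h.1
    have hleft : stagesLeft c = Nat.log 2 c.uncovered.card := by simp [stagesLeft, hph]
    by_cases hU : 8 * (τ : ℝ) * Real.logb 2 n ≤ c.uncovered.card
    · simp only [step, hph, if_pos hU]
      rw [PMF.tsum_map_mul]
      set δ := ENNReal.ofReal (stageFailure n τ)
      have hgood : ∀ S, (if Inv G n τ R L (9 * k + 51) (N + 1) (startStage c S) then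
          δ * stagesLeft (startStage c S) else 1) ≤
          δ * ((Nat.log 2 c.uncovered.card - 1 : ℕ) : ℝ≥0∞) +
            (if ¬ GoodSelection c.uncovered f τ (7 * τ * Real.logb 2 n) S then 1 else 0) := by
        intro S
        by_cases hS : GoodSelection c.uncovered f τ (7 * τ * Real.logb 2 n) S
        · rw [if_pos (.inr (.inl (h.startStage hG hn hτ hU hQ hQτ hf hS)))]
          exact le_self_add
        · rw [if_pos hS]
          split_ifs
          · exact le_self_add
          · exact le_add_self
      have hlog : 1 ≤ Nat.log 2 c.uncovered.card := by
        have h1 := one_le_logb hn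
        have h2 : (1 : ℝ) ≤ τ := by exact_mod_cast hτ
        have : (2 : ℝ) ≤ c.uncovered.card := by nlinarith
        exact Nat.log_pos one_lt_two (by exact_mod_cast this)
      calc _ ≤ ∑' S, randomSubset c.uncovered (selProb n τ c.uncovered.card)
              (selProb_le_one n τ _) S * (δ * ((Nat.log 2 c.uncovered.card - 1 : ℕ) : ℝ≥0∞) +
            (if ¬ GoodSelection c.uncovered f τ (7 * τ * Real.logb 2 n) S then 1 else 0)) :=
            ENNReal.tsum_le_tsum fun S => mul_le_mul_right (hgood S) _
        _ ≤ δ * ((Nat.log 2 c.uncovered.card - 1 : ℕ) : ℝ≥0∞) + δ := by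
            simp_rw [mul_add]
            rw [ENNReal.tsum_add]
            exact add_le_add (PMF.tsum_mul_le _ fun _ => le_rfl)
              (tsum_randomSubset_not_good f hQ hQτ hn hτ hU)
        _ = δ * stagesLeft c := by
            rw [hleft, ← mul_add_one]
            congr 1
            exact_mod_cast Nat.sub_add_cancel hlog
    · simp only [step, hph, if_neg hU]
      rw [PMF.tsum_pure_mul, if_pos]
      · simp [stagesLeft, finish]
      · exact .inr (.inr ⟨rfl, h.finish hn (not_le.1 hU) hR hℓ hℓ1 hL hmin hRn⟩)
  · have hph := h.1
    simp only [step, hph]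
    rw [PMF.tsum_pure_mul]
    rcases h.growNext hG hLhop with ⟨h', hlog⟩ | ⟨h', hlog⟩
    · rw [if_pos (.inl h')]
      gcongr
      simpa [stagesLeft, hph, h'.1] using hlog
    · rw [if_pos (.inr (.inl h'))]
      gcongr
      simp [stagesLeft, hph, h'.1, hlog]
  · simp only [step, hph]
    rw [PMF.tsum_pure_mul, if_pos (.inr (.inr ⟨hph, h⟩))]

theorem Inv.successful [Fintype V] {C : ℝ} (hmin : 0 < G.minWeight)
    (h : Inv G n τ R L C N c)
    (hN : (Nat.log 2 n + 4 * R) * (L + 1) + L + Nat.log 2 n + 1 < N) :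
    c.phase = .done ∧ Successful G n τ C c := by
  have hbound : ∀ i m, BaseInv G n τ R i m c →
      i ≤ Nat.log 2 n ∧ (i + m) * (L + 1) ≤ (Nat.log 2 n + 4 * R) * (L + 1) := by
    intro i m hb
    have h1 := hb.stages_le
    have h2 : m < 2 ^ m := Nat.lt_two_pow_self
    have h3 := hb.delta_eq ▸ hb.delta_le
    have h4 : 2 ^ m ≤ G.minWeight * 2 ^ m := Nat.le_mul_of_pos_left _ hmin
    exact ⟨by omega, Nat.mul_le_mul_right _ (by omega)⟩
  rcases h with ⟨-, i, m, hb, htr, hN'⟩ | ⟨-, -, -, i, m, j, hb, -, -, hj, -, htr, hN'⟩ | h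
  · have := hbound i m hb
    omega
  · have := hbound i m hb
    omega
  · exact h

theorem le_prTerminatesWith [Fintype V] {k : ℕ} (hcard : Fintype.card V = n) (hn : 2 ≤ n)
    (hG : G.Connected) (hw : ∀ e ∈ G.edgeSet, G.weight e ≤ n ^ k) (hτ : 1 ≤ τ) (hτn : τ ≤ n)
    (hlarge : 8 * (τ : ℝ) * Real.logb 2 n ≤ n) :
    1 - 1 / (n : ℝ≥0∞) ≤ prTerminatesWith G τ (Successful G n τ (9 * k + 51)) := by
  classical
  have hlog1 := one_le_logb hn
  have hτlt : τ < n := by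
    have h1 : (1 : ℝ) ≤ τ := by exact_mod_cast hτ
    have : (τ : ℝ) < n := by nlinarith
    exact_mod_cast this
  have : Nontrivial V := Fintype.one_lt_card_iff_nontrivial.1 (by omega)
  have hmin := G.minWeight_pos hG
  obtain ⟨K, hKτ, hKR⟩ := exists_radius_eq_optRadius (G := G) hτ (hτn.trans_eq hcard.symm)
  set R := optRadius G τ with hR
  obtain ⟨x, y, hxy, hxyR⟩ := exists_ne_wdist_le_optRadius (G := G) hτ (hτlt.trans_eq hcard.symm)
  have hhop := G.hopBound_ell hG R
  have hℓ1 := hhop.one_le hxyR hxy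
  have hRn : R ≤ n ^ (k + 1) := by
    have := optRadius_le hG hw hτ (hτn.trans_eq hcard.symm)
    rwa [hcard, ← pow_succ'] at this
  have hL : G.HopBound (4 * R) (8 * G.ell R) := fun u v huv => by
    obtain ⟨p, hp, hl⟩ := hhop.mul hG 4 u v (by omega)
    exact ⟨p, hp, by omega⟩
  have hinit := outerInv_init (τ := τ) (L := 8 * G.ell R) hcard
    ((G.minWeight_le_wdist hG hxy).trans hxyR)
  set M := (Nat.log 2 n + 4 * R) * (8 * G.ell R + 1) + 8 * G.ell R + Nat.log 2 n + 2 with hM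
  have hfail := PMF.tsum_invariant_le (step n τ) (run G τ) (fun N => by rw [run, hcard]) (init G)
    rfl (Inv G n τ R (8 * G.ell R) (9 * k + 51))
    (fun c => ENNReal.ofReal (stageFailure n τ) * stagesLeft c) (.inl hinit)
    (fun N c hc => tsum_step_le hG hn hτ rfl rfl hℓ1 rfl hL hmin hRn
      (fun u => Finset.mem_image_of_mem K.centerOf (Finset.mem_univ u))
      (K.numClusters_eq_card_image.symm.trans hKτ)
      (fun u => (K.wdist_centerOf_le G u).trans_eq hKR) hc) M
  refine le_trans ?_ (le_iSup _ M)
  refine PMF.one_sub_le_toOuterMeasure _ (fun c hc => hc.successful hmin (by omega))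
    (hfail.trans ?_)
  have hU : (init G).uncovered = Finset.univ := by simp [Config.uncovered, init]
  have hleft : stagesLeft (init G) = Nat.log 2 n := by
    rw [← hcard, ← Finset.card_univ, ← hU]
    rfl
  have h0 : (0 : ℝ) ≤ Nat.log 2 n := Nat.cast_nonneg _
  rw [hleft, ← ENNReal.ofReal_natCast, ← ENNReal.ofReal_mul' h0]
  refine (ENNReal.ofReal_le_ofReal (stageFailure_mul_log_le hn hlarge)).trans_eq ?_
  rw [ENNReal.ofReal_div_of_pos (by positivity), ENNReal.ofReal_one, ENNReal.ofReal_natCast]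

theorem one_le_prTerminatesWith [Fintype V] {k : ℕ} (hcard : Fintype.card V = n) (hn : 2 ≤ n)
    (hsmall : n < 8 * (τ : ℝ) * Real.logb 2 n) :
    1 ≤ prTerminatesWith G τ (Successful G n τ (9 * k + 51)) := by
  have hU : (init G).uncovered = Finset.univ := by simp [Config.uncovered, init]
  have hcardU : (init G).uncovered.card = n := by rw [hU, Finset.card_univ, hcard]
  have hrun : run G τ 1 = PMF.pure (finish (init G)) := by
    rw [run, run, PMF.pure_bind, hcard, step]
    simp only [show (init G).phase = .outer from rfl]
    rw [if_neg (by rw [hcardU]; exact not_le.2 hsmall)]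
  refine le_trans (le_of_eq ?_) (le_iSup _ 1)
  rw [hrun, PMF.toOuterMeasure_pure_apply, if_pos]
  have hlog1 := one_le_logb hn
  refine ⟨rfl, ⟨⟨fun v => v, fun v => rfl⟩, fun v => ?_, ?_, ?_⟩, ?_, ?_⟩
  · simp [finish, hU]
  · have h1 : ((⟨fun v => v, fun v => rfl⟩ : Clustering V).numClusters : ℝ) = n := by
      classical
      simp [Clustering.numClusters, hcard]
    rw [h1]
    have h2 := mul_le_mul_of_nonneg_left hlog1
      (by positivity : 0 ≤ 8 * τ * Real.logb 2 n)
    have h3 : 0 ≤ (9 * k + 43) * (τ * Real.logb 2 n ^ 2) := by positivity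
    nlinarith
  · have h1 : (⟨fun v => v, fun v => rfl⟩ : Clustering V).radius G = 0 := by
      simp [Clustering.radius]
    rw [h1, Nat.cast_zero]
    positivity
  · change (([] : List ℕ).length : ℝ) ≤ _
    rw [List.length_nil, Nat.cast_zero]
    positivity
  · intro Δ hΔ
    exact absurd hΔ List.not_mem_nil

end ClusterAlg

theorem theorem1 (k : ℕ) :
    ∃ C : ℝ, 0 < C ∧
      ∀ (V : Type*) [Fintype V] [LinearOrder V] (G : WGraph V) (n τ : ℕ),
        Fintype.card V = n → 2 ≤ n → G.Connected →
        (∀ e ∈ G.edgeSet, G.weight e ≤ n ^ k) →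
        1 ≤ τ → τ ≤ n →
        1 - 1 / (n : ℝ≥0∞) ≤
          ClusterAlg.prTerminatesWith G τ fun out =>
            (∃ K : Clustering V,
              (∀ v, out.assign v = some (K.centerOf v)) ∧
              (K.numClusters : ℝ) ≤ C * τ * Real.logb 2 n ^ 2 ∧
              (K.radius G : ℝ) ≤ C * optRadius G τ * Real.logb 2 n) ∧
            (out.trace.length : ℝ) ≤ C * G.ell (optRadius G τ) * Real.logb 2 n ∧
            (∀ Δ ∈ out.trace, (Δ : ℝ) ≤ C * optRadius G τ) := by
  refine ⟨9 * k + 51, by positivity, ?_⟩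
  intro V _ _ G n τ hcard hn hG hw hτ hτn
  rcases le_or_gt (8 * (τ : ℝ) * Real.logb 2 n) n with h | h
  · exact ClusterAlg.le_prTerminatesWith hcard hn hG hw hτ hτn h
  · exact tsub_le_self.trans (ClusterAlg.one_le_prTerminatesWith hcard hn h)
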